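/- **Theorem (Multicalibration generalization guarantee).** There is a universal constant $C>0$ such that the following holds. Let $\mathcal X$ be a measurable space, $\mathcal H$ a class of measurable functions $h:\mathcal X\to\mathbb R$ that is closed under affine transformations ($h\in\mathcal H$, $a,b\in\mathbb R$ imply $ah+b\in\mathcal H$) and has finite pseudodimension $d$: $d$ is the largest $k$ for which there are $x_1,\dots,x_k\in\mathcal X$ and $y_1,\dots,y_k\in\mathbb R$ such that for every $b\in\{0,1\}^k$ some $h\in\mathcal H$ satisfies $h(x_i)>y_i\Leftrightarrow b_i=1$ for all $i$. Let $A_{\mathcal H}$ be a squared error regression oracle for $\mathcal H$: for every distribution $\mathcal D'$ on $\mathcal X\times[0,1]$ it returns $A_{\mathcal H}(\mathcal D')\in\arg\min_{h\in\mathcal H}\mathbb E_{(x,y)\sim\mathcal D'}[(h(x)-y)^2]$. Let $f:\mathcal X\to[0,1]$ be measurable, let $\mathcal D$ be a distribution on $\mathcal X\times[0,1]$, and let $\epsilon,\delta,\alpha,B>0$. For a distribution $\mathcal D'$, $\mathrm{LSBoost}(f,\alpha,A_{\mathcal H},\mathcal D',B)$ is the following algorithm. Put $m=\lceil 2B/\alpha\rceil$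 and $[1/m]=\{0,\frac1m,\dots,1\}$, and let $\mathrm{Round}(\cdot;m)$ replace each value by the nearest point of $[1/m]$ (ties upwards). Let $f_0=\mathrm{Round}(f;m)$ and, for $t\ge 0$, $f_{t+1}=\mathrm{Round}\big(\sum_{v\in[1/m]}\mathbf 1[f_t(x)=v]\,h^{t+1}_v(x);m\big)$, where $h_v^{t+1}=A_{\mathcal H}(\mathcal D'\mid f_t(x)=v)$ (a fixed member of $\mathcal H$, chosen by the oracle, if the level set is null). With $\mathrm{err}_t=\mathbb E_{(x,y)\sim\mathcal D'}[(f_t(x)-y)^2]$, let $T$ be the first $t\ge1$ with $\mathrm{err}_{t-1}-\mathrm{err}_t<\frac{\alpha}{2B}$; the output is $f_{T-1}$. Let $D$ be a sample of $n$ points drawn i.i.d. from $\mathcal D$, and let $f_{T-1}$ be the output of $\mathrm{LSBoost}(f,\alpha,A_{\mathcal H},D,B)$, run on the empirical distribution of $D$. Assume that $(D,x)\mapsto f_{T-1}(x)$ is measurable, that $$n\ \ge\ C\left(\frac{dB^3\log^2(dB/\alpha)}{\alpha^3\epsilon^2}+\frac{\log(1/\delta)}{\epsilon^2}\right),$$ and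 that $\epsilon\le\frac{\alpha}{4B}$. Then with probability at least $1-2\delta$ over $D$, the model $f_{T-1}$ is $2\alpha$-approximately multicalibrated with respect to $\mathcal D$ and $\mathcal H_B=\{h\in\mathcal H:\ h(x)^2\le B\ \text{for all } x\in\mathcal X\}$, that is, for every $h\in\mathcal H_B$, $$\sum_{v\in R(f_{T-1})}\Pr_{(x,y)\sim\mathcal D}[f_{T-1}(x)=v]\Big(\mathbb E_{(x,y)\sim\mathcal D}\big[h(x)(y-v)\mid f_{T-1}(x)=v\big]\Big)^2\le 2\alpha .$$ -/

import Mathlib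

open MeasureTheory ProbabilityTheory
open scoped ENNReal

namespace LSBoost

noncomputable section

/-- Labelled examples `(x, y)` with features in `X` and a label in `[0, 1]`. -/
abbrev Example (X : Type*) := X × unitInterval

variable {X : Type*}

/-- `H` is closed under affine transformations `h ↦ a h + b`. -/
def AffineClosed (H : Set (X → ℝ)) : Prop :=
  ∀ h ∈ H, ∀ a b : ℝ, (fun x => a * h x + b) ∈ H

/-- `H_B`: the members of `H` whose square is bounded by `B`. -/
def boundedPart (H : Set (X → ℝ)) (B : ℝ) : Set (X → ℝ) :=
  {h ∈ H | ∀ x, h x ^ 2 ≤ B}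

/-- `H` pseudo-shatters the points `x` with witnesses `y`. -/
def PseudoShatters (H : Set (X → ℝ)) {k : ℕ} (x : Fin k → X) (y : Fin k → ℝ) : Prop :=
  ∀ b : Fin k → Bool, ∃ h ∈ H, ∀ i, y i < h (x i) ↔ b i = true

/-- The pseudodimension of `H` is (finite and equal to) `d`. Repeated points cannot be
pseudo-shattered, so there is no need to ask for `k` distinct ones. -/
def HasPseudodimension (H : Set (X → ℝ)) (d : ℕ) : Prop :=
  IsGreatest {k : ℕ | ∃ (x : Fin k → X) (y : Fin k → ℝ), PseudoShatters H x y} d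

/-- The grid `[1/m] = {0, 1/m, …, (m-1)/m, 1}`. -/
def grid (m : ℕ) : Finset ℝ :=
  (Finset.range (m + 1)).image fun i : ℕ => (i : ℝ) / m

/-- Rounding a real number to the nearest point of `[1/m]`, ties being rounded up. -/
def roundTo (m : ℕ) (z : ℝ) : ℝ :=
  ((max 0 (min (m : ℤ) ⌊(m : ℝ) * z + 1 / 2⌋) : ℤ) : ℝ) / m

theorem roundTo_mem_grid (m : ℕ) (z : ℝ) : roundTo m z ∈ grid m := by
  set k : ℤ := max 0 (min (m : ℤ) ⌊(m : ℝ) * z + 1 / 2⌋) with hk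
  have h0 : 0 ≤ k := le_max_left _ _
  have hm : k ≤ m := max_le (by positivity) (min_le_left _ _)
  refine Finset.mem_image.2 ⟨k.toNat, Finset.mem_range.2 (by omega), ?_⟩
  have : ((k.toNat : ℤ) : ℝ) = (k : ℝ) := by rw [Int.toNat_of_nonneg h0]
  rw [Int.cast_natCast] at this
  rw [this, roundTo]

theorem abs_sub_roundTo_le (m : ℕ) (hm : 0 < m) (z : ℝ) {w : ℝ} (hw : w ∈ grid m) :
    |z - roundTo m z| ≤ |z - w| := by
  obtain ⟨i, hi, rfl⟩ := Finset.mem_image.1 hw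
  have him : i ≤ m := by simpa [Nat.lt_succ_iff] using hi
  have hm' : (0 : ℝ) < m := by exact_mod_cast hm
  set q : ℤ := ⌊(m : ℝ) * z + 1 / 2⌋ with hq
  set k : ℤ := max 0 (min (m : ℤ) q) with hk
  have key : |(m : ℝ) * z - k| ≤ |(m : ℝ) * z - ((i : ℤ) : ℝ)| := by
    have h1 : (q : ℝ) ≤ (m : ℝ) * z + 1 / 2 := Int.floor_le _
    have h2 : (m : ℝ) * z + 1 / 2 < q + 1 := Int.lt_floor_add_one _
    rcases lt_trichotomy (i : ℤ) k with h | h | h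
    · have hkq : k ≤ q := by omega
      have hkq' : (k : ℝ) ≤ q := by exact_mod_cast hkq
      have h' : ((i : ℤ) : ℝ) + 1 ≤ k := by exact_mod_cast h
      rw [abs_le, abs_of_nonneg (by linarith)]
      constructor <;> linarith
    · rw [h]
    · have hkq : q ≤ k := by omega
      have hkq' : (q : ℝ) ≤ k := by exact_mod_cast hkq
      have h' : (k : ℝ) + 1 ≤ ((i : ℤ) : ℝ) := by exact_mod_cast h
      rw [abs_le, abs_of_nonpos (by linarith)]
      constructor <;> linarith
  have e : ∀ t : ℝ, |z - t / m| = |(m : ℝ) * z - t| / m := by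
    intro t
    rw [← abs_of_pos hm', ← abs_div, abs_of_pos hm']
    congr 1
    field_simp
  have : roundTo m z = (k : ℝ) / m := rfl
  rw [this, e, e]
  rw [Int.cast_natCast] at key
  gcongr

/-- The discretization parameter `m = 2B/α`, rounded up to an integer. -/
def gridSize (α B : ℝ) : ℕ := ⌈2 * B / α⌉₊

section Measure

variable [MeasurableSpace X]

/-- The conditional distribution `D | (f(x) = v)` (the zero measure when the level set is null). -/
def levelCond (D : Measure (Example X)) (f : X → ℝ) (v : ℝ) : Measure (Example X) :=
  D[|{z | f z.1 = v}]

/-- Expected squared error of a model, with values in `[0, ∞]`. -/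
def sqErrorENN (D : Measure (Example X)) (h : X → ℝ) : ℝ≥0∞ :=
  ∫⁻ z, ENNReal.ofReal ((h z.1 - (z.2 : ℝ)) ^ 2) ∂D

/-- `A` is a squared error regression oracle for `H`: on every distribution over `X × [0, 1]` it
returns a member of `H` of least squared error. On measures that are not distributions (in the
algorithm: the conditional law on a null level set) it may return any member of `H`. -/
structure IsRegressionOracle (H : Set (X → ℝ)) (A : Measure (Example X) → X → ℝ) : Prop where
  mem : ∀ D, A D ∈ H
  le : ∀ D, IsProbabilityMeasure D → ∀ h ∈ H, sqErrorENN D (A D) ≤ sqErrorENN D h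

/-- The models `f_0, f_1, f_2, …` that the algorithm computes on the distribution `D`:
`f_0 = Round(f; m)` and `f_{t+1} = Round(∑_v 1[f_t = v] h_v^{t+1}; m)` with
`h_v^{t+1} = A(D | f_t = v)`. -/
def iter (f : X → ℝ) (α : ℝ) (A : Measure (Example X) → X → ℝ) (D : Measure (Example X))
    (B : ℝ) : ℕ → X → ℝ
  | 0 => fun x => roundTo (gridSize α B) (f x)
  | t + 1 => fun x => roundTo (gridSize α B)
      (∑ v ∈ grid (gridSize α B),
        if iter f α A D B t x = v then A (levelCond D (iter f α A D B t) v) x else 0)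

/-- `err_t`, the squared error of `f_t` on `D`. -/
def err (f : X → ℝ) (α : ℝ) (A : Measure (Example X) → X → ℝ) (D : Measure (Example X))
    (B : ℝ) (t : ℕ) : ℝ :=
  ∫ z, (iter f α A D B t z.1 - (z.2 : ℝ)) ^ 2 ∂D

/-- The final round `T`: the first `t ≥ 1` with `err_{t-1} - err_t < α / (2B)`. (Since
`err_{-1} = ∞`, the loop is always entered at `t = 0`.) -/
def finalRound (f : X → ℝ) (α : ℝ) (A : Measure (Example X) → X → ℝ) (D : Measure (Example X))
    (B : ℝ) : ℕ :=
  sInf {t : ℕ | 1 ≤ t ∧ err f α A D B (t - 1) - err f α A D B t < α / (2 * B)}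

/-- The algorithm halts, so that `finalRound` is the round at which its loop is left. -/
theorem finalRound_spec (f : X → ℝ) {α : ℝ} (hα : 0 < α) (A : Measure (Example X) → X → ℝ)
    (D : Measure (Example X)) {B : ℝ} (hB : 0 < B) :
    1 ≤ finalRound f α A D B ∧
      err f α A D B (finalRound f α A D B - 1) - err f α A D B (finalRound f α A D B)
        < α / (2 * B) := by
  refine Nat.sInf_mem
    (s := {t : ℕ | 1 ≤ t ∧ err f α A D B (t - 1) - err f α A D B t < α / (2 * B)}) ?_
  by_contra hne
  rw [Set.not_nonempty_iff_eq_empty] at hne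
  have hstep : ∀ t : ℕ, α / (2 * B) ≤ err f α A D B t - err f α A D B (t + 1) := by
    intro t
    by_contra hlt
    have : t + 1 ∈ ({t : ℕ | 1 ≤ t ∧
        err f α A D B (t - 1) - err f α A D B t < α / (2 * B)} : Set ℕ) :=
      ⟨by omega, by simpa using hlt⟩
    rw [hne] at this
    exact this
  have hsum : ∀ t : ℕ, err f α A D B t ≤ err f α A D B 0 - t * (α / (2 * B)) := by
    intro t
    induction t with
    | zero => simp
    | succ t ih =>
      have := hstep t
      push_cast
      linarith
  have hc : 0 < α / (2 * B) := by positivity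
  obtain ⟨N, hN⟩ := exists_nat_gt (err f α A D B 0 / (α / (2 * B)))
  rw [div_lt_iff₀ hc] at hN
  have h0 : 0 ≤ err f α A D B N := integral_nonneg fun z => sq_nonneg _
  linarith [hsum N]

/-- The model `f_{T-1}` output by the algorithm `LSBoost(f, α, A, D, B)`. -/
def output (f : X → ℝ) (α : ℝ) (A : Measure (Example X) → X → ℝ) (D : Measure (Example X))
    (B : ℝ) : X → ℝ :=
  iter f α A D B (finalRound f α A D B - 1)

/-- The empirical distribution of a data set of `n` labelled examples. -/
def empirical {n : ℕ} (S : Fin n → Example X) : Measure (Example X) :=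
  (n : ℝ≥0∞)⁻¹ • ∑ i, Measure.dirac (S i)

/-- `K₂(f, h, D) = ∑_{v ∈ R(f)} Pr[f(x) = v] · (E[h(x) (y - v) | f(x) = v])²`. -/
def K₂ (f h : X → ℝ) (D : Measure (Example X)) : ℝ≥0∞ :=
  ∑' v : Set.range f, D {z | f z.1 = v} *
    ENNReal.ofReal ((∫ z, h z.1 * ((z.2 : ℝ) - v) ∂(levelCond D f v)) ^ 2)

/-- `f` is `α`-approximately multicalibrated with respect to `D` and `H`. -/
def ApproxMulticalibrated (α : ℝ) (D : Measure (Example X)) (H : Set (X → ℝ))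
    (f : X → ℝ) : Prop :=
  ∀ h ∈ H, K₂ f h D ≤ ENNReal.ofReal α

end Measure

end

end LSBoost

namespace LSBoost

variable {X : Type*}

/-! Write b = B/α and m = ⌈2b⌉. The central quantity is the gain 2η(v)h(x)(y - v) - η(v)². For |h| ≤
1 it is a lower bound for the drop in squared error when the prediction v is replaced by v +
η(v)h(x). The oracle, affine closure and the halting rule keep every mean gain of the output on the
sample below 1/(2b) + 5/(4m) ≤ 9/(8b), where 5/(4m) is the cost of rounding
(`integral_gain_output_le`). If the output is not 2α-multicalibrated on the population, scale a
violating h by 1/√B and let η(v) be the conditional mean of h(x)(y - v): the mean gain exceeds 2α/B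
= 2/b. Moving h to a finite L¹(μ)-net and η to a grid-valued function costs at most 1/(4b)
(`exists_lt_integral_gain`). Failure therefore forces some gain to differ between population and
sample by at least 5/(8b).

Such a gap is unlikely. Comparison with a ghost sample and random swaps reduce it to a statement
about 2n fixed points. A swap changes the training sample and hence the model, but by Sauer's lemma,
applied level by level over at most m rounds, all possible outputs have at most (m + 1)(2nm +
1)^(d(m + 1)m) traces on these points. The net has at most (32nm + 1)^d elements by a packing
argument. Hoeffding's inequality and a union bound over traces, net and increments leave an exponent
of order d b² log(nb) against n/b². The latter wins once n is of order d b⁵ log²(db), up to the term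
for δ; the assumed sample size and ε ≤ 1/(4b) provide this. -/

/-! ### Counting the traces of boosted models -/

theorem sum_choose_le_pow (M d : ℕ) :
    ∑ i ∈ Finset.Iic d, M.choose i ≤ (M + 1) ^ d := by
  induction d with
  | zero => rw [show Finset.Iic 0 = {0} from rfl]; simp
  | succ d ih =>
    have : Finset.Iic (d + 1) = insert (d + 1) (Finset.Iic d) := by
      ext i; simp only [Finset.mem_Iic, Finset.mem_insert]; omega
    rw [this, Finset.sum_insert (by simp)]
    have h1 : M.choose (d + 1) ≤ M ^ (d + 1) := Nat.choose_le_pow M (d + 1)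
    have h2 : M ^ d ≤ (M + 1) ^ d := Nat.pow_le_pow_left (Nat.le_succ M) d
    have h3 : M ^ (d + 1) ≤ M * (M + 1) ^ d := by
      rw [pow_succ, mul_comm]; exact Nat.mul_le_mul_left M h2
    calc _ ≤ M * (M + 1) ^ d + (M + 1) ^ d := by omega
      _ = (M + 1) ^ (d + 1) := by ring

/-- Sauer's lemma for the subgraphs of a class of pseudodimension `d`. -/
theorem exists_finset_subgraph_traces {H : Set (X → ℝ)} {d : ℕ} (hd : HasPseudodimension H d)
    {J : Type*} [Fintype J] [DecidableEq J] (p : J → X) (t : J → ℝ) :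
    ∃ P : Finset (Finset J), P.card ≤ (Fintype.card J + 1) ^ d ∧
      ∀ h ∈ H, (Finset.univ.filter fun j => t j < h (p j)) ∈ P := by
  classical
  set P : Finset (Finset J) :=
    Finset.univ.filter fun s => ∃ h ∈ H, s = Finset.univ.filter fun j => t j < h (p j) with hP
  refine ⟨P, ?_, fun h hh => by simpa [hP] using ⟨h, hh, rfl⟩⟩
  -- A set shattered by the traces is, once enumerated, pseudo-shattered with the thresholds as
  -- witnesses.
  have hvc : P.vcDim ≤ d := by
    refine Finset.sup_le fun s hs => ?_
    rw [Finset.mem_shatterer] at hs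
    refine hd.2 ⟨fun i => p (s.equivFin.symm i), fun i => t (s.equivFin.symm i), fun b => ?_⟩
    set u : Finset J := Finset.univ.filter fun j => ∃ i, b i = true ∧ (s.equivFin.symm i : J) = j
      with hu
    have hus : u ⊆ s := by
      intro j hj
      obtain ⟨i, -, rfl⟩ := (Finset.mem_filter.1 hj).2
      exact (s.equivFin.symm i).2
    obtain ⟨w, hw, hwu⟩ := hs hus
    obtain ⟨h, hh, rfl⟩ := (Finset.mem_filter.1 hw).2
    refine ⟨h, hh, fun i => ?_⟩
    have h1 : (s.equivFin.symm i : J) ∈ u ↔ b i = true := by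
      simp only [hu, Finset.mem_filter, Finset.mem_univ, true_and]
      constructor
      · rintro ⟨i', hb, he⟩
        rwa [← s.equivFin.symm.injective (Subtype.ext he)]
      · exact fun hb => ⟨i, hb, rfl⟩
    rw [← h1, ← hwu]
    simp
  calc P.card ≤ P.shatterer.card := P.card_le_card_shatterer
    _ ≤ ∑ k ∈ Finset.Iic P.vcDim, (Fintype.card J).choose k := Finset.card_shatterer_le_sum_vcDim
    _ ≤ ∑ k ∈ Finset.Iic d, (Fintype.card J).choose k :=
        Finset.sum_le_sum_of_subset (Finset.Iic_subset_Iic.2 hvc)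
    _ ≤ _ := sum_choose_le_pow _ _

/-- The grid index is the number of midpoints (j + 1/2)/m not exceeding z, which reduces rounding to
threshold tests. -/
theorem roundTo_eq_card (m : ℕ) (z : ℝ) :
    roundTo m z =
      ((Finset.univ.filter fun j : Fin m => (j : ℝ) + 1 ≤ m * z + 1 / 2).card : ℝ) / m := by
  rw [roundTo]
  congr 1
  set q : ℤ := ⌊(m : ℝ) * z + 1 / 2⌋ with hq
  set k : ℕ := (max 0 (min (m : ℤ) q)).toNat with hk
  have hkm : k ≤ m := by omega
  have hkz : max 0 (min (m : ℤ) q) = (k : ℤ) := by omega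
  have : (Finset.univ.filter fun j : Fin m => (j : ℝ) + 1 ≤ m * z + 1 / 2)
      = Finset.univ.filter fun j : Fin m => (j : ℕ) < k := by
    ext j
    simp only [Finset.mem_filter, Finset.mem_univ, true_and]
    have h1 : ((j : ℝ) + 1 ≤ m * z + 1 / 2) ↔ ((j : ℤ) + 1 ≤ q) := by
      rw [hq, Int.le_floor]; push_cast; rfl
    rw [h1]
    have := j.2
    omega
  rw [this, hkz, Fin.card_filter_val_lt, min_eq_right hkm]
  simp

theorem AffineClosed.neg_mem {H : Set (X → ℝ)} (hH : AffineClosed H) {h : X → ℝ} (hh : h ∈ H) :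
    (fun x => -h x) ∈ H := by
  simpa using hH h hh (-1) 0

/-- The rounded members of a class of pseudodimension `d` take at most `(N m + 1)^d` value
patterns on `N` points. -/
theorem exists_finset_round_traces {H : Set (X → ℝ)} {d : ℕ} (hd : HasPseudodimension H d)
    (hH : AffineClosed H) {m : ℕ} (hm : 0 < m) {ι : Type*} [Fintype ι] (x : ι → X) :
    ∃ P : Finset (ι → ℝ), P.card ≤ (Fintype.card ι * m + 1) ^ d ∧
      ∀ h ∈ H, (fun i => roundTo m (h (x i))) ∈ P := by
  classical
  -- Subgraph tests are strict, whereas rounding ties upwards tests h(x) ≥ (j + 1/2)/m. Passing to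
  -- -h, this is the negation of the strict test -h(x) > (1/2 - (j + 1))/m.
  obtain ⟨Q, hQ, hQm⟩ := exists_finset_subgraph_traces hd
    (fun j : ι × Fin m => x j.1) (fun j => (1 / 2 - ((j.2 : ℝ) + 1)) / m)
  refine ⟨Q.image fun s i => ((Finset.univ.filter fun j : Fin m => (i, j) ∉ s).card : ℝ) / m,
    Finset.card_image_le.trans (by simpa using hQ), fun h hh => ?_⟩
  refine Finset.mem_image.2 ⟨_, hQm _ (hH.neg_mem hh), ?_⟩
  funext i
  rw [roundTo_eq_card]
  congr 3
  ext j
  have hm' : (0 : ℝ) < m := by exact_mod_cast hm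
  simp only [Finset.mem_filter, Finset.mem_univ, true_and, not_lt]
  rw [le_div_iff₀ hm']
  constructor <;> intro h <;> linarith

theorem card_grid_le (m : ℕ) : (grid m).card ≤ m + 1 :=
  Finset.card_image_le.trans (by simp)

/-- The models that `t` rounds of boosting can produce with arbitrary members of `H`. -/
def boostClass (H : Set (X → ℝ)) (m : ℕ) (f : X → ℝ) : ℕ → Set (X → ℝ)
  | 0 => {fun x => roundTo m (f x)}
  | t + 1 => {g | ∃ g₀ ∈ boostClass H m f t, ∃ u : ℝ → X → ℝ, (∀ v, u v ∈ H) ∧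
      g = fun x => roundTo m (∑ v ∈ grid m, if g₀ x = v then u v x else 0)}

theorem mem_grid_of_mem_boostClass {H : Set (X → ℝ)} {m : ℕ} {f : X → ℝ} {t : ℕ} {g : X → ℝ}
    (hg : g ∈ boostClass H m f t) (x : X) : g x ∈ grid m := by
  cases t with
  | zero => rw [show g = _ from hg]; exact roundTo_mem_grid _ _
  | succ t =>
    obtain ⟨g₀, -, u, -, rfl⟩ := hg
    exact roundTo_mem_grid _ _

/-- Only one summand survives at each point, so a round is determined by the previous trace and one
rounded trace per level. With N points, each round multiplies the count by at most (N m + 1)^(d (m +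
1)). -/
theorem exists_finset_boostClass_traces {H : Set (X → ℝ)} {d : ℕ} (hd : HasPseudodimension H d)
    (hH : AffineClosed H) {m : ℕ} (hm : 0 < m) (f : X → ℝ) {ι : Type*} [Fintype ι] (x : ι → X)
    (t : ℕ) :
    ∃ P : Finset (ι → ℝ), P.card ≤ (Fintype.card ι * m + 1) ^ (d * (m + 1) * t) ∧
      ∀ g ∈ boostClass H m f t, (fun i => g (x i)) ∈ P := by
  classical
  induction t with
  | zero =>
    refine ⟨{fun i => roundTo m (f (x i))}, by simp, fun g hg => ?_⟩
    rw [show g = _ from hg]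
    exact Finset.mem_singleton_self _
  | succ t ih =>
    obtain ⟨P, hP, hPm⟩ := ih
    obtain ⟨Q, hQ, hQm⟩ := exists_finset_round_traces hd hH hm x
    refine ⟨(P ×ˢ (Finset.univ : Finset (↥(grid m) → ↥Q))).image fun r i =>
      if hv : r.1 i ∈ grid m then (r.2 ⟨r.1 i, hv⟩ : ι → ℝ) i else 0, ?_, ?_⟩
    · refine Finset.card_image_le.trans ?_
      rw [Finset.card_product, Finset.card_univ, Fintype.card_fun, Fintype.card_coe,
        Fintype.card_coe]
      set M := Fintype.card ι * m + 1
      calc P.card * Q.card ^ (grid m).card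
          ≤ M ^ (d * (m + 1) * t) * (M ^ d) ^ (m + 1) := by
            refine Nat.mul_le_mul hP ((Nat.pow_le_pow_left hQ _).trans ?_)
            exact Nat.pow_le_pow_right (pow_pos (Nat.succ_pos _) _) (card_grid_le m)
        _ = M ^ (d * (m + 1) * (t + 1)) := by
            rw [← pow_mul, ← pow_add]; ring_nf
    · rintro g ⟨g₀, hg₀, u, hu, rfl⟩
      refine Finset.mem_image.2 ⟨(fun i => g₀ (x i),
        fun v => ⟨fun i => roundTo m (u v (x i)), hQm _ (hu v)⟩), by simp [hPm _ hg₀], ?_⟩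
      funext i
      have hv := mem_grid_of_mem_boostClass hg₀ (x i)
      simp [hv]

theorem iter_mem_boostClass [MeasurableSpace X] {H : Set (X → ℝ)}
    {A : Measure (Example X) → X → ℝ} (hA : IsRegressionOracle H A) (f : X → ℝ) (α : ℝ)
    (D : Measure (Example X)) (B : ℝ) (t : ℕ) :
    iter f α A D B t ∈ boostClass H (gridSize α B) f t := by
  induction t with
  | zero => rfl
  | succ t ih => exact ⟨_, ih, _, fun v => hA.mem (levelCond D (iter f α A D B t) v), rfl⟩

/-! ### The cost of rounding -/

theorem mem_Icc_of_mem_grid {m : ℕ} {v : ℝ} (hv : v ∈ grid m) : v ∈ Set.Icc (0 : ℝ) 1 := by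
  obtain ⟨i, hi, rfl⟩ := Finset.mem_image.1 hv
  have him : i ≤ m := by simpa [Nat.lt_succ_iff] using hi
  have him' : (i : ℝ) ≤ m := by exact_mod_cast him
  exact ⟨by positivity, div_le_one_of_le₀ him' (by positivity)⟩

theorem abs_sub_roundTo_le_inv {m : ℕ} (hm : 0 < m) {z : ℝ} (hz : z ∈ Set.Icc (0 : ℝ) 1) :
    |z - roundTo m z| ≤ 1 / (2 * m) := by
  have hm' : (0 : ℝ) < m := by exact_mod_cast hm
  set q : ℤ := ⌊(m : ℝ) * z + 1 / 2⌋ with hq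
  have h1 : (q : ℝ) ≤ (m : ℝ) * z + 1 / 2 := Int.floor_le _
  have h2 : (m : ℝ) * z + 1 / 2 < q + 1 := Int.lt_floor_add_one _
  have hz0 : 0 ≤ (m : ℝ) * z := mul_nonneg hm'.le hz.1
  have hz1 : (m : ℝ) * z ≤ m := mul_le_of_le_one_right hm'.le hz.2
  have hq0 : 0 ≤ q := Int.floor_nonneg.2 (by linarith)
  have hqm : q ≤ m := by
    have : (q : ℝ) < ((m + 1 : ℤ) : ℝ) := by push_cast; linarith
    have := Int.cast_lt.1 this
    omega
  have hr : roundTo m z = q / m := by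
    rw [roundTo, ← hq, min_eq_right hqm, max_eq_right hq0]
  have : z - roundTo m z = (m * z - q) / m := by rw [hr]; field_simp
  rw [this, abs_div, abs_of_pos hm', div_le_div_iff₀ hm' (by positivity)]
  have : |(m : ℝ) * z - q| ≤ 1 / 2 := abs_le.2 ⟨by linarith, by linarith⟩
  nlinarith

theorem roundTo_of_nonpos (m : ℕ) {z : ℝ} (hz : z ≤ 0) : roundTo m z = 0 := by
  have : ⌊(m : ℝ) * z + 1 / 2⌋ < 1 := by
    rw [Int.floor_lt]
    have : (m : ℝ) * z ≤ 0 := mul_nonpos_of_nonneg_of_nonpos (by positivity) hz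
    push_cast
    linarith
  rw [roundTo, max_eq_left (by omega)]
  simp

theorem roundTo_of_one_le {m : ℕ} (hm : 0 < m) {z : ℝ} (hz : 1 ≤ z) : roundTo m z = 1 := by
  have hm' : (0 : ℝ) < m := by exact_mod_cast hm
  have : (m : ℤ) ≤ ⌊(m : ℝ) * z + 1 / 2⌋ := by
    rw [Int.le_floor]
    push_cast
    nlinarith
  rw [roundTo, min_eq_left this, max_eq_right (by positivity), Int.cast_natCast,
    div_self hm'.ne']

/-- Rounding hardly increases the squared error. -/
theorem roundTo_sub_sq_le {m : ℕ} (hm : 0 < m) (z : ℝ) {y : ℝ} (hy : y ∈ Set.Icc (0 : ℝ) 1) :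
    (roundTo m z - y) ^ 2 ≤ (z - y) ^ 2 + 5 / (4 * m) := by
  have hm' : (1 : ℝ) ≤ m := by exact_mod_cast hm
  have hpos : (0 : ℝ) ≤ 5 / (4 * m) := by positivity
  -- Outside [0, 1] rounding moves z to the nearer endpoint, hence closer to y.
  rcases le_total z 0 with h0 | h0
  · rw [roundTo_of_nonpos m h0]
    nlinarith [hy.1]
  rcases le_total 1 z with h1 | h1
  · rw [roundTo_of_one_le hm h1]
    nlinarith [hy.2]
  have hr := abs_le.1 (abs_sub_roundTo_le_inv hm ⟨h0, h1⟩)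
  set r := roundTo m z
  set s : ℝ := 1 / (2 * m) with hs
  have hs0 : 0 < s := by positivity
  -- Since s ≤ 1/2, the error 2s + s² is at most 5s/2 = 5/(4m).
  have hs1 : s ≤ 1 / 2 := by
    rw [hs, div_le_div_iff₀ (by positivity) (by positivity)]; linarith
  have h5 : 5 / (4 * (m : ℝ)) = 5 / 2 * s := by rw [hs]; field_simp; norm_num
  rw [h5]
  have hzy : |z - y| ≤ 1 := abs_le.2 ⟨by linarith [hy.2], by linarith [hy.1]⟩
  have hrz : |r - z| ≤ s := abs_le.2 ⟨by linarith [hr.2], by linarith [hr.1]⟩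
  have e : (r - y) ^ 2 = (z - y) ^ 2 + 2 * ((z - y) * (r - z)) + (r - z) ^ 2 := by ring
  have h1 : (z - y) * (r - z) ≤ s := by
    calc _ ≤ |z - y| * |r - z| := by rw [← abs_mul]; exact le_abs_self _
      _ ≤ 1 * s := by gcongr
      _ = s := one_mul s
  have h2 : (r - z) ^ 2 ≤ s ^ 2 := by rw [← sq_abs]; gcongr
  nlinarith

/-! ### Level sets, gains and levelwise regression -/

theorem biUnion_level {g : X → ℝ} {s : Finset ℝ} (hs : ∀ x, g x ∈ s) :
    ⋃ v ∈ s, {z : Example X | g z.1 = v} = Set.univ :=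
  Set.eq_univ_of_forall fun z => by simpa using hs z.1

theorem pairwiseDisjoint_level (g : X → ℝ) (s : Set ℝ) :
    s.PairwiseDisjoint fun v => {z : Example X | g z.1 = v} := by
  intro v _ w _ hvw
  refine Set.disjoint_left.2 fun z hz hz' => hvw ?_
  exact (show g z.1 = v from hz).symm.trans hz'

/-- The decrease of the squared error at `(x, y)`, up to a quadratic term, when the prediction `v`
is changed to `v + η(v) h(x)`. -/
def gain (η : ℝ → ℝ) (h : X → ℝ) (v : ℝ) (z : Example X) : ℝ :=
  2 * η v * h z.1 * ((z.2 : ℝ) - v) - η v ^ 2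

theorem gain_mem_Icc {η : ℝ → ℝ} (hη : ∀ v, |η v| ≤ 1) {h : X → ℝ} (hh : ∀ x, |h x| ≤ 1)
    {v : ℝ} (hv : v ∈ Set.Icc (0 : ℝ) 1) (z : Example X) :
    gain η h v z ∈ Set.Icc (-3 : ℝ) 2 := by
  have h1 := hη v
  have h2 : |h z.1| ≤ 1 := hh _
  have h3 : |(z.2 : ℝ) - v| ≤ 1 :=
    abs_le.2 ⟨by linarith [z.2.2.1, hv.2], by linarith [z.2.2.2, hv.1]⟩
  have h4 : |η v * h z.1 * ((z.2 : ℝ) - v)| ≤ 1 := by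
    rw [abs_mul, abs_mul]
    exact mul_le_one₀ (mul_le_one₀ h1 (abs_nonneg _) h2) (abs_nonneg _) h3
  have h5 : η v ^ 2 ≤ 1 := (sq_le_one_iff_abs_le_one _).2 h1
  have h6 := abs_le.1 h4
  unfold gain
  exact ⟨by nlinarith [h6.1], by nlinarith [h6.2, sq_nonneg (η v)]⟩

theorem sqError_mem_Icc {g : X → ℝ} (hg : ∀ x, g x ∈ Set.Icc (-1 : ℝ) 2) (z : Example X) :
    (g z.1 - (z.2 : ℝ)) ^ 2 ∈ Set.Icc (0 : ℝ) 4 := by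
  have := hg z.1
  refine ⟨sq_nonneg _, ?_⟩
  nlinarith [z.2.2.1, z.2.2.2, this.1, this.2]

section

variable [MeasurableSpace X]

theorem measurable_roundTo (m : ℕ) : Measurable (roundTo m) := by
  have : roundTo m = (fun q : ℤ => ((max 0 (min (m : ℤ) q) : ℤ) : ℝ) / m) ∘
      fun z : ℝ => ⌊(m : ℝ) * z + 1 / 2⌋ := rfl
  rw [this]
  exact measurable_from_top.comp (Int.measurable_floor.comp (by fun_prop))

theorem measurable_of_mem_boostClass {H : Set (X → ℝ)} (hHm : ∀ h ∈ H, Measurable h) {m : ℕ}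
    {f : X → ℝ} (hf : Measurable f) {t : ℕ} {g : X → ℝ} (hg : g ∈ boostClass H m f t) :
    Measurable g := by
  induction t generalizing g with
  | zero => rw [show g = _ from hg]; exact (measurable_roundTo m).comp hf
  | succ t ih =>
    obtain ⟨g₀, hg₀, u, hu, rfl⟩ := hg
    refine (measurable_roundTo m).comp (Finset.measurable_fun_sum _ fun v _ => ?_)
    exact Measurable.ite (ih hg₀ (measurableSet_singleton v)) (hHm _ (hu v)) measurable_const

theorem measurableSet_level {g : X → ℝ} (hg : Measurable g) (v : ℝ) :
    MeasurableSet {z : Example X | g z.1 = v} :=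
  (hg.comp measurable_fst) (measurableSet_singleton v)

theorem lintegral_eq_sum_level (D : Measure (Example X)) {g : X → ℝ} (hg : Measurable g)
    {s : Finset ℝ} (hs : ∀ x, g x ∈ s) (F : Example X → ℝ≥0∞) :
    ∫⁻ z, F z ∂D = ∑ v ∈ s, ∫⁻ z in {z | g z.1 = v}, F z ∂D := by
  rw [← lintegral_biUnion_finset (pairwiseDisjoint_level g s)
    (fun v _ => measurableSet_level hg v), biUnion_level hs, setLIntegral_univ]

theorem integral_eq_sum_level {D : Measure (Example X)} {g : X → ℝ} (hg : Measurable g)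
    {s : Finset ℝ} (hs : ∀ x, g x ∈ s) {F : Example X → ℝ} (hF : Integrable F D) :
    ∫ z, F z ∂D = ∑ v ∈ s, ∫ z in {z | g z.1 = v}, F z ∂D := by
  rw [← integral_biUnion_finset s (fun v _ => measurableSet_level hg v)
    (pairwiseDisjoint_level g s) (fun v _ => hF.integrableOn), biUnion_level hs, setIntegral_univ]

/-- Levelwise regression is optimal among the levelwise members of `H`. -/
theorem sqErrorENN_levelwise_oracle_le {H : Set (X → ℝ)} {A : Measure (Example X) → X → ℝ}
    (hA : IsRegressionOracle H A) (D : Measure (Example X)) [IsFiniteMeasure D] {g : X → ℝ}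
    (hg : Measurable g) {s : Finset ℝ} (hs : ∀ x, g x ∈ s) {u : ℝ → X → ℝ} (hu : ∀ v, u v ∈ H) :
    sqErrorENN D (fun x => ∑ v ∈ s, if g x = v then A (levelCond D g v) x else 0)
      ≤ sqErrorENN D (fun x => u (g x) x) := by
  rw [sqErrorENN, sqErrorENN, lintegral_eq_sum_level D hg hs, lintegral_eq_sum_level D hg hs]
  refine Finset.sum_le_sum fun v hv => ?_
  have hms := measurableSet_level hg v
  have e1 : ∫⁻ z in {z | g z.1 = v}, ENNReal.ofReal
      (((∑ w ∈ s, if g z.1 = w then A (levelCond D g w) z.1 else 0) - (z.2 : ℝ)) ^ 2) ∂D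
      = ∫⁻ z in {z | g z.1 = v}, ENNReal.ofReal ((A (levelCond D g v) z.1 - (z.2 : ℝ)) ^ 2) ∂D := by
    refine setLIntegral_congr_fun hms fun z hz => ?_
    have hz' : g z.1 = v := hz
    simp [hz', hv]
  have e2 : ∫⁻ z in {z | g z.1 = v}, ENNReal.ofReal ((u (g z.1) z.1 - (z.2 : ℝ)) ^ 2) ∂D
      = ∫⁻ z in {z | g z.1 = v}, ENNReal.ofReal ((u v z.1 - (z.2 : ℝ)) ^ 2) ∂D := by
    refine setLIntegral_congr_fun hms fun z hz => ?_
    have hz' : g z.1 = v := hz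
    simp [hz']
  rw [e1, e2]
  -- On a null level set the oracle's choice is arbitrary, but it contributes nothing.
  by_cases h0 : D {z | g z.1 = v} = 0
  · rw [Measure.restrict_eq_zero.2 h0]; simp
  have hp : IsProbabilityMeasure (levelCond D g v) := cond_isProbabilityMeasure h0
  have key := hA.le _ hp _ (hu v)
  unfold sqErrorENN at key
  conv at key => lhs; rw [levelCond, ProbabilityTheory.cond, lintegral_smul_measure]
  conv at key => rhs; rw [levelCond, ProbabilityTheory.cond, lintegral_smul_measure]
  simp only [smul_eq_mul] at key
  refine (ENNReal.mul_le_mul_iff_right ?_ ?_).1 key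
  · exact ENNReal.inv_ne_zero.2 (measure_ne_top D _)
  · exact ENNReal.inv_ne_top.2 h0

theorem measurable_gain {η : ℝ → ℝ} (hη : Measurable η) {h : X → ℝ} (hh : Measurable h) :
    Measurable fun p : ℝ × Example X => gain η h p.1 p.2 := by
  unfold gain
  have : Measurable fun p : ℝ × Example X => ((p.2.2 : unitInterval) : ℝ) :=
    measurable_subtype_coe.comp (measurable_snd.comp measurable_snd)
  have := hη.comp (measurable_fst : Measurable fun p : ℝ × Example X => p.1)
  have := hh.comp (measurable_fst.comp measurable_snd : Measurable fun p : ℝ × Example X => p.2.1)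
  fun_prop

theorem measurable_gain_comp {η : ℝ → ℝ} (hη : Measurable η) {h : X → ℝ} (hh : Measurable h)
    {g : X → ℝ} (hg : Measurable g) : Measurable fun z : Example X => gain η h (g z.1) z :=
  (measurable_gain hη hh).comp ((hg.comp measurable_fst).prodMk measurable_id)

theorem integrable_of_mem_Icc {Ω : Type*} [MeasurableSpace Ω] (P : Measure Ω) [IsFiniteMeasure P]
    {F : Ω → ℝ} (hF : Measurable F) {a b : ℝ} (h : ∀ z, F z ∈ Set.Icc a b) : Integrable F P :=
  Integrable.of_mem_Icc a b hF.aemeasurable (ae_of_all _ h)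

theorem gridSize_pos {α B : ℝ} (hα : 0 < α) (hB : 0 < B) : 0 < gridSize α B :=
  Nat.ceil_pos.2 (by positivity)

theorem iter_mem_grid (f : X → ℝ) (α : ℝ) (A : Measure (Example X) → X → ℝ)
    (D : Measure (Example X)) (B : ℝ) (t : ℕ) (x : X) :
    iter f α A D B t x ∈ grid (gridSize α B) := by
  cases t with
  | zero => exact roundTo_mem_grid _ _
  | succ t => exact roundTo_mem_grid _ _

theorem measurable_sqError {g : X → ℝ} (hg : Measurable g) :
    Measurable fun z : Example X => (g z.1 - (z.2 : ℝ)) ^ 2 :=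
  ((hg.comp measurable_fst).sub (measurable_subtype_coe.comp measurable_snd)).pow_const 2

theorem sqErrorENN_eq_ofReal (D : Measure (Example X)) [IsFiniteMeasure D] {g : X → ℝ}
    (hgm : Measurable g) (hg : ∀ x, g x ∈ Set.Icc (-1 : ℝ) 2) :
    sqErrorENN D g = ENNReal.ofReal (∫ z, (g z.1 - (z.2 : ℝ)) ^ 2 ∂D) :=
  (ofReal_integral_eq_lintegral_ofReal
    (integrable_of_mem_Icc D (measurable_sqError hgm) (sqError_mem_Icc hg))
    (ae_of_all _ fun _ => sq_nonneg _)).symm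

/-! ### Rounds of boosting and the halting rule -/

section LSBoost

variable {H : Set (X → ℝ)} {A : Measure (Example X) → X → ℝ} {f : X → ℝ}

theorem measurable_iter (hA : IsRegressionOracle H A) (hHm : ∀ h ∈ H, Measurable h)
    (hf : Measurable f) (α : ℝ) (D : Measure (Example X)) (B : ℝ) (t : ℕ) :
    Measurable (iter f α A D B t) :=
  measurable_of_mem_boostClass hHm hf (iter_mem_boostClass hA f α D B t)

/-- A round of boosting does at least as well as any levelwise member of `H`, up to rounding. -/
theorem err_succ_le (hA : IsRegressionOracle H A) (hHm : ∀ h ∈ H, Measurable h)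
    (hf : Measurable f) {α B : ℝ} (hα : 0 < α) (hB : 0 < B) (D : Measure (Example X))
    [IsProbabilityMeasure D] (t : ℕ) {u : ℝ → X → ℝ} (hu : ∀ v, u v ∈ H)
    (hum : Measurable fun x => u (iter f α A D B t x) x)
    (hu2 : ∀ x, u (iter f α A D B t x) x ∈ Set.Icc (-1 : ℝ) 2) :
    err f α A D B (t + 1) ≤ ∫ z, (u (iter f α A D B t z.1) z.1 - (z.2 : ℝ)) ^ 2 ∂D
      + 5 / (4 * gridSize α B) := by
  have hm := gridSize_pos hα hB
  have hg := measurable_iter hA hHm hf α D B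
  have hI : ∀ t x, iter f α A D B t x ∈ Set.Icc (-1 : ℝ) 2 := fun t x => by
    have := mem_Icc_of_mem_grid (iter_mem_grid f α A D B t x)
    exact ⟨by linarith [this.1], by linarith [this.2]⟩
  have h0 : 0 ≤ ∫ z, (u (iter f α A D B t z.1) z.1 - (z.2 : ℝ)) ^ 2 ∂D :=
    integral_nonneg fun _ => sq_nonneg _
  -- The comparison runs in [0, ∞] because the oracle's choices need not be bounded.
  rw [← ENNReal.ofReal_le_ofReal_iff (by positivity), ENNReal.ofReal_add h0 (by positivity), err,
    ← sqErrorENN_eq_ofReal D (hg (t + 1)) (hI (t + 1)), ← sqErrorENN_eq_ofReal D hum hu2]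
  refine le_trans ?_ (add_le_add_left (sqErrorENN_levelwise_oracle_le hA D (hg t)
    (iter_mem_grid f α A D B t) hu) _)
  unfold sqErrorENN
  calc _ ≤ ∫⁻ z, (ENNReal.ofReal (((∑ v ∈ grid (gridSize α B), if iter f α A D B t z.1 = v then
        A (levelCond D (iter f α A D B t) v) z.1 else 0) - (z.2 : ℝ)) ^ 2)
        + ENNReal.ofReal (5 / (4 * gridSize α B))) ∂D := by
        refine lintegral_mono fun z => ?_
        rw [← ENNReal.ofReal_add (sq_nonneg _) (by positivity)]
        exact ENNReal.ofReal_le_ofReal (roundTo_sub_sq_le hm _ z.2.2)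
    _ = _ := by
        rw [lintegral_add_right _ measurable_const]
        simp

/-- On the distribution that the algorithm is run on, no member of `H` improves the output by
much. -/
theorem integral_gain_output_le (hA : IsRegressionOracle H A) (hHm : ∀ h ∈ H, Measurable h)
    (hH : AffineClosed H) (hf : Measurable f) {α B : ℝ} (hα : 0 < α) (hB : 0 < B)
    (D : Measure (Example X)) [IsProbabilityMeasure D] {η : ℝ → ℝ} (hηm : Measurable η)
    (hη : ∀ v, |η v| ≤ 1) {h : X → ℝ} (hh : h ∈ H) (hh1 : ∀ x, |h x| ≤ 1) :
    ∫ z, gain η h (output f α A D B z.1) z ∂D ≤ α / (2 * B) + 5 / (4 * gridSize α B) := by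
  obtain ⟨hT1, hT⟩ := finalRound_spec f hα A D hB
  unfold output
  obtain ⟨t, ht⟩ : ∃ t, finalRound f α A D B = t + 1 := ⟨_, (Nat.sub_add_cancel hT1).symm⟩
  rw [ht] at hT ⊢
  rw [Nat.add_sub_cancel] at hT ⊢
  set g := iter f α A D B t with hgdef
  have hg : Measurable g := measurable_iter hA hHm hf α D B t
  have hgI : ∀ x, g x ∈ Set.Icc (0 : ℝ) 1 :=
    fun x => mem_Icc_of_mem_grid (iter_mem_grid f α A D B t x)
  set u : ℝ → X → ℝ := fun v x => η v * h x + v with hu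
  have hhm := hHm h hh
  have hum : Measurable fun x => u (g x) x := ((hηm.comp hg).mul hhm).add hg
  have hu2 : ∀ x, u (g x) x ∈ Set.Icc (-1 : ℝ) 2 := fun x => by
    have h1 : |η (g x) * h x| ≤ 1 := by
      rw [abs_mul]; exact mul_le_one₀ (hη _) (abs_nonneg _) (hh1 x)
    have h2 := abs_le.1 h1
    exact ⟨by linarith [(hgI x).1], by linarith [(hgI x).2]⟩
  have key := err_succ_le hA hHm hf hα hB D t (u := u) (fun v => hH h hh _ _) hum hu2
  have hgI' : ∀ x, g x ∈ Set.Icc (-1 : ℝ) 2 := fun x =>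
    ⟨by linarith [(hgI x).1], by linarith [(hgI x).2]⟩
  have i1 := integrable_of_mem_Icc D (measurable_sqError hg) (sqError_mem_Icc hgI')
  have i2 := integrable_of_mem_Icc D (measurable_sqError hum) (sqError_mem_Icc hu2)
  have hle : ∫ z, gain η h (g z.1) z ∂D
      ≤ ∫ z, ((g z.1 - (z.2 : ℝ)) ^ 2 - (u (g z.1) z.1 - (z.2 : ℝ)) ^ 2) ∂D := by
    refine integral_mono (integrable_of_mem_Icc D (measurable_gain_comp hηm hhm hg)
      fun z => gain_mem_Icc hη hh1 (hgI z.1) z) (i1.sub i2) fun z => ?_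
    -- The exact decrease is 2ηh(y - g) - η²h², and h² ≤ 1 bounds it below by the gain.
    have : h z.1 ^ 2 ≤ 1 := (sq_le_one_iff_abs_le_one _).2 (hh1 z.1)
    simp only [gain, hu]
    nlinarith [sq_nonneg (η (g z.1)), mul_nonneg (sq_nonneg (η (g z.1))) (sub_nonneg.2 this)]
  rw [integral_sub i1 i2] at hle
  have e : err f α A D B t = ∫ z, (g z.1 - (z.2 : ℝ)) ^ 2 ∂D := rfl
  linarith

/-- The number of rounds is at most the size of the grid. -/
theorem finalRound_sub_one_le (hA : IsRegressionOracle H A) (hHm : ∀ h ∈ H, Measurable h)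
    (hf : Measurable f) {α B : ℝ} (hα : 0 < α) (hB : 0 < B) (D : Measure (Example X))
    [IsProbabilityMeasure D] : finalRound f α A D B - 1 ≤ gridSize α B := by
  have hc : 0 < α / (2 * B) := by positivity
  have hsum : ∀ t, t ≤ finalRound f α A D B - 1 →
      err f α A D B t + t * (α / (2 * B)) ≤ err f α A D B 0 := by
    intro t
    induction t with
    | zero => simp
    | succ t ih =>
      intro ht
      have h1 := ih (by omega)
      -- Rounds before T violate the halting condition, so each lowers the error, initially at most
      -- 1, by at least α/(2B).
      have h2 : t + 1 ∉ {t : ℕ | 1 ≤ t ∧ err f α A D B (t - 1) - err f α A D B t < α / (2 * B)} :=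
        Nat.notMem_of_lt_sInf (show t + 1 < finalRound f α A D B by omega)
      have h3 : α / (2 * B) ≤ err f α A D B t - err f α A D B (t + 1) := by simpa using h2
      push_cast
      linarith
  have h1 := hsum _ le_rfl
  have h0 : 0 ≤ err f α A D B (finalRound f α A D B - 1) := integral_nonneg fun _ => sq_nonneg _
  have h2 : err f α A D B 0 ≤ 1 := by
    have hb : ∀ z : Example X, (iter f α A D B 0 z.1 - (z.2 : ℝ)) ^ 2 ∈ Set.Icc (0 : ℝ) 1 := by
      intro z
      have := mem_Icc_of_mem_grid (iter_mem_grid f α A D B 0 z.1)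
      refine ⟨sq_nonneg _, (sq_le_one_iff_abs_le_one _).2 (abs_le.2 ⟨?_, ?_⟩)⟩
      · linarith [this.1, z.2.2.2]
      · linarith [this.2, z.2.2.1]
    calc err f α A D B 0 ≤ ∫ _, (1 : ℝ) ∂D :=
          integral_mono (integrable_of_mem_Icc D
            (measurable_sqError (measurable_iter hA hHm hf α D B 0)) hb) (integrable_const _)
            fun z => (hb z).2
      _ = 1 := by simp
  have h3 : ((finalRound f α A D B - 1 : ℕ) : ℝ) * (α / (2 * B)) ≤ 1 := by linarith
  have h4 : ((finalRound f α A D B - 1 : ℕ) : ℝ) ≤ 2 * B / α := by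
    rw [le_div_iff₀ hα]
    have := mul_le_mul_of_nonneg_right h3 (show (0 : ℝ) ≤ 2 * B by positivity)
    calc _ = ((finalRound f α A D B - 1 : ℕ) : ℝ) * (α / (2 * B)) * (2 * B) := by field_simp
      _ ≤ _ := by linarith
  exact_mod_cast h4.trans (Nat.le_ceil _)

end LSBoost

end

/-! ### Normalized hypotheses and discretized increments -/

/-- The members of `H` with values in `[-1, 1]`. -/
def unitPart (H : Set (X → ℝ)) : Set (X → ℝ) :=
  {h ∈ H | ∀ x, |h x| ≤ 1}

theorem div_sqrt_mem_unitPart {H : Set (X → ℝ)} (hH : AffineClosed H) {B : ℝ} (hB : 0 < B)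
    {h : X → ℝ} (hh : h ∈ boundedPart H B) : (fun x => h x / √B) ∈ unitPart H := by
  refine ⟨by simpa [div_eq_inv_mul] using hH h hh.1 (√B)⁻¹ 0, fun x => ?_⟩
  rw [← sq_le_one_iff_abs_le_one, div_pow, Real.sq_sqrt hB.le]
  exact div_le_one_of_le₀ (hh.2 x) hB.le

/-- The function on the grid with values `2 e(v) - 1`, extended by zero. -/
noncomputable def gridFun {m : ℕ} (e : ↥(grid m) → ↥(grid m)) (v : ℝ) : ℝ :=
  open Classical in if hv : v ∈ grid m then 2 * (e ⟨v, hv⟩ : ℝ) - 1 else 0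

theorem abs_gridFun_le {m : ℕ} (e : ↥(grid m) → ↥(grid m)) (v : ℝ) : |gridFun e v| ≤ 1 := by
  unfold gridFun
  split_ifs with hv
  · have := mem_Icc_of_mem_grid (e ⟨v, hv⟩).2
    exact abs_le.2 ⟨by linarith [this.1], by linarith [this.2]⟩
  · simp

theorem measurable_gridFun {m : ℕ} (e : ↥(grid m) → ↥(grid m)) : Measurable (gridFun e) := by
  refine (measurable_const (a := (0 : ℝ))).measurable_of_countable_ne
    ((grid m).finite_toSet.subset fun v hv => ?_).countable
  by_contra h
  exact hv (by simp [gridFun, show v ∉ grid m from h])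

/-- The values 2e - 1 with e on the grid have spacing 2/m in [-1, 1], so the nearest one is within
1/m. -/
theorem exists_gridFun_near {m : ℕ} (hm : 0 < m) {E : ℝ → ℝ} (hE : ∀ v, |E v| ≤ 1) :
    ∃ e : ↥(grid m) → ↥(grid m), ∀ v ∈ grid m, |gridFun e v - E v| ≤ 1 / m := by
  refine ⟨fun v => ⟨roundTo m ((E v + 1) / 2), roundTo_mem_grid _ _⟩, fun v hv => ?_⟩
  have h1 := abs_le.1 (hE v)
  have h2 := abs_le.1 (abs_sub_roundTo_le_inv hm (z := (E v + 1) / 2)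
    ⟨by linarith [h1.1], by linarith [h1.2]⟩)
  have e : 1 / (m : ℝ) = 2 * (1 / (2 * m)) := by field_simp
  rw [e]
  simp only [gridFun, hv, dif_pos]
  exact abs_le.2 ⟨by linarith [h2.2], by linarith [h2.1]⟩

theorem abs_gain_sub_gain_le {η : ℝ → ℝ} (hη : ∀ v, |η v| ≤ 1) (h h' : X → ℝ) {v : ℝ}
    (hv : v ∈ Set.Icc (0 : ℝ) 1) (z : Example X) :
    |gain η h v z - gain η h' v z| ≤ 2 * |h z.1 - h' z.1| := by
  have e : gain η h v z - gain η h' v z = 2 * (η v * ((z.2 : ℝ) - v) * (h z.1 - h' z.1)) := by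
    unfold gain; ring
  have h3 : |(z.2 : ℝ) - v| ≤ 1 :=
    abs_le.2 ⟨by linarith [z.2.2.1, hv.2], by linarith [z.2.2.2, hv.1]⟩
  rw [e, abs_mul, abs_mul, abs_mul, abs_two]
  have : |η v| * |(z.2 : ℝ) - v| ≤ 1 := mul_le_one₀ (hη v) (abs_nonneg _) h3
  have := mul_le_mul_of_nonneg_right this (abs_nonneg (h z.1 - h' z.1))
  linarith

theorem abs_residual_le {h : X → ℝ} {b : ℝ} (hh : ∀ x, |h x| ≤ b) {v : ℝ}
    (hv : v ∈ Set.Icc (0 : ℝ) 1) (z : Example X) : |h z.1 * ((z.2 : ℝ) - v)| ≤ b := by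
  have h3 : |(z.2 : ℝ) - v| ≤ 1 :=
    abs_le.2 ⟨by linarith [z.2.2.1, hv.2], by linarith [z.2.2.2, hv.1]⟩
  rw [abs_mul]
  calc _ ≤ b * 1 := mul_le_mul (hh _) h3 (abs_nonneg _) ((abs_nonneg _).trans (hh z.1))
    _ = b := mul_one b

/-! ### Multicalibration error and population gain -/

section Measure

variable [MeasurableSpace X]

/-- A value that is not attained has an empty level set and contributes zero, so the range can be
exchanged for the whole grid. -/
theorem K₂_eq_sum {g : X → ℝ} {s : Finset ℝ} (hs : ∀ x, g x ∈ s) (h : X → ℝ)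
    (D : Measure (Example X)) :
    K₂ g h D = ∑ v ∈ s, D {z | g z.1 = v} *
      ENNReal.ofReal ((∫ z, h z.1 * ((z.2 : ℝ) - v) ∂(levelCond D g v)) ^ 2) := by
  set c : ℝ → ℝ≥0∞ := fun v => D {z | g z.1 = v} *
      ENNReal.ofReal ((∫ z, h z.1 * ((z.2 : ℝ) - v) ∂(levelCond D g v)) ^ 2) with hc
  have h0 : ∀ v, v ∉ Set.range g → c v = 0 := by
    intro v hv
    have : {z : Example X | g z.1 = v} = ∅ :=
      Set.eq_empty_of_forall_notMem fun z hz => hv ⟨z.1, hz⟩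
    simp [hc, this]
  calc K₂ g h D = ∑' v : Set.range g, c v := rfl
    _ = ∑' v, c v := tsum_subtype_eq_of_support_subset fun v hv => by
        by_contra h; exact hv (h0 v h)
    _ = ∑ v ∈ s, c v := tsum_eq_sum fun v hv => h0 v fun ⟨x, hx⟩ => hv (hx ▸ hs x)

/-- The conditional mean of `h(x) (y - v)` on a level set. -/
noncomputable def levelBias (D : Measure (Example X)) (g h : X → ℝ) (v : ℝ) : ℝ :=
  ∫ z, h z.1 * ((z.2 : ℝ) - v) ∂(levelCond D g v)

theorem measurable_residual {h : X → ℝ} (hh : Measurable h) (v : ℝ) :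
    Measurable fun z : Example X => h z.1 * ((z.2 : ℝ) - v) :=
  (hh.comp measurable_fst).mul ((measurable_subtype_coe.comp measurable_snd).sub_const v)

theorem abs_levelBias_le (D : Measure (Example X)) [IsFiniteMeasure D] (g : X → ℝ) {h : X → ℝ}
    {b : ℝ} (hb : 0 ≤ b) (hh : ∀ x, |h x| ≤ b) {v : ℝ} (hv : v ∈ Set.Icc (0 : ℝ) 1) :
    |levelBias D g h v| ≤ b := by
  by_cases h0 : D {z | g z.1 = v} = 0
  · have : levelCond D g v = 0 := by
      rw [levelCond, ProbabilityTheory.cond_eq_zero]; exact Or.inr h0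
    simpa [levelBias, this] using hb
  · have hp : IsProbabilityMeasure (levelCond D g v) := cond_isProbabilityMeasure h0
    have := norm_integral_le_of_norm_le_const (μ := levelCond D g v)
      (f := fun z : Example X => h z.1 * ((z.2 : ℝ) - v)) (ae_of_all _ (abs_residual_le hh hv))
    simpa [levelBias] using this

theorem measureReal_mul_levelBias (D : Measure (Example X)) [IsFiniteMeasure D] (g h : X → ℝ)
    (v : ℝ) : D.real {z | g z.1 = v} * levelBias D g h v =
      ∫ z in {z | g z.1 = v}, h z.1 * ((z.2 : ℝ) - v) ∂D := by
  by_cases h0 : D {z | g z.1 = v} = 0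
  · rw [Measure.restrict_eq_zero.2 h0]; simp [Measure.real, h0]
  · rw [levelBias, levelCond, ProbabilityTheory.cond, integral_smul_measure, Measure.real,
      ENNReal.toReal_inv, smul_eq_mul, mul_inv_cancel_left₀]
    exact (ENNReal.toReal_pos h0 (measure_ne_top D _)).ne'

theorem integral_gain_eq_sum (D : Measure (Example X)) [IsFiniteMeasure D] {g h : X → ℝ}
    (hg : Measurable g) {s : Finset ℝ} (hs : ∀ x, g x ∈ s) (hsI : ∀ v ∈ s, v ∈ Set.Icc (0 : ℝ) 1)
    (hh : Measurable h) (hh1 : ∀ x, |h x| ≤ 1) {η : ℝ → ℝ} (hηm : Measurable η)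
    (hη : ∀ v, |η v| ≤ 1) :
    ∫ z, gain η h (g z.1) z ∂D =
      ∑ v ∈ s, D.real {z | g z.1 = v} * (2 * η v * levelBias D g h v - η v ^ 2) := by
  rw [integral_eq_sum_level hg hs (integrable_of_mem_Icc D (measurable_gain_comp hηm hh hg)
    fun z => gain_mem_Icc hη hh1 (hsI _ (hs _)) z)]
  refine Finset.sum_congr rfl fun v hv => ?_
  have e : ∫ z in {z | g z.1 = v}, gain η h (g z.1) z ∂D =
      ∫ z in {z | g z.1 = v}, (2 * η v * (h z.1 * ((z.2 : ℝ) - v)) - η v ^ 2) ∂D := by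
    refine setIntegral_congr_fun (measurableSet_level hg v) fun z hz => ?_
    have hz' : g z.1 = v := hz
    simp only [gain, hz']
    ring
  have hi : Integrable (fun z : Example X => h z.1 * ((z.2 : ℝ) - v))
      (D.restrict {z | g z.1 = v}) :=
    integrable_of_mem_Icc _ (measurable_residual hh v)
      fun z => abs_le.1 (abs_residual_le hh1 (hsI v hv) z)
  rw [e, integral_sub (hi.const_mul _) (integrable_const _), integral_const_mul,
    ← measureReal_mul_levelBias]
  simp only [integral_const, measureReal_restrict_apply_univ, smul_eq_mul]
  ring

theorem sum_measureReal_level (D : Measure (Example X)) [IsProbabilityMeasure D] {g : X → ℝ}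
    (hg : Measurable g) {s : Finset ℝ} (hs : ∀ x, g x ∈ s) :
    ∑ v ∈ s, D.real {z | g z.1 = v} = 1 := by
  have := integral_eq_sum_level (D := D) hg hs (integrable_const (1 : ℝ))
  simpa using this.symm

theorem K₂_eq_ofReal_sum {g h : X → ℝ} {s : Finset ℝ} (hs : ∀ x, g x ∈ s)
    (D : Measure (Example X)) [IsFiniteMeasure D] :
    K₂ g h D = ENNReal.ofReal (∑ v ∈ s, D.real {z | g z.1 = v} * levelBias D g h v ^ 2) := by
  rw [K₂_eq_sum hs, ENNReal.ofReal_sum_of_nonneg fun v _ => by positivity]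
  refine Finset.sum_congr rfl fun v _ => ?_
  rw [ENNReal.ofReal_mul measureReal_nonneg, ofReal_measureReal]
  rfl

/-- This settles the case B ≤ 2α: |h| ≤ √B and |y - v| ≤ 1 bound each squared bias by B, and the
level weights sum to one. -/
theorem approxMulticalibrated_of_le {H : Set (X → ℝ)} {g : X → ℝ} (hg : Measurable g)
    {s : Finset ℝ} (hs : ∀ x, g x ∈ s) (hsI : ∀ v ∈ s, v ∈ Set.Icc (0 : ℝ) 1)
    (D : Measure (Example X)) [IsProbabilityMeasure D] {B β : ℝ} (hB : 0 ≤ B) (hβ : B ≤ β) :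
    ApproxMulticalibrated β D (boundedPart H B) g := by
  intro h hh
  rw [K₂_eq_ofReal_sum hs]
  refine ENNReal.ofReal_le_ofReal (le_trans ?_ hβ)
  calc _ ≤ ∑ v ∈ s, D.real {z | g z.1 = v} * B := by
        refine Finset.sum_le_sum fun v hv => mul_le_mul_of_nonneg_left ?_ measureReal_nonneg
        have := abs_levelBias_le D g (Real.sqrt_nonneg B)
          (fun x => Real.abs_le_sqrt (hh.2 x)) (hsI v hv)
        rw [← sq_abs]
        calc _ ≤ √B ^ 2 := by gcongr
          _ = B := Real.sq_sqrt hB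
    _ = B := by rw [← Finset.sum_mul, sum_measureReal_level D hg hs, one_mul]

/-- A model that is not multicalibrated can be improved by an element of a finite set. -/
theorem exists_lt_integral_gain {H : Set (X → ℝ)} (hH : AffineClosed H)
    (hHm : ∀ h ∈ H, Measurable h) {m : ℕ} (hm : 0 < m) {g : X → ℝ} (hg : Measurable g)
    (hgm : ∀ x, g x ∈ grid m) (D : Measure (Example X)) [IsProbabilityMeasure D] {B β ρ : ℝ}
    (hB : 0 < B) (hgB : ¬ ApproxMulticalibrated β D (boundedPart H B) g)
    {N : Finset (X → ℝ)} (hNH : ↑N ⊆ unitPart H)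
    (hN : ∀ h ∈ unitPart H, ∃ h' ∈ N, ∫ z, |h z.1 - h' z.1| ∂D ≤ ρ) :
    ∃ h ∈ N, ∃ e : ↥(grid m) → ↥(grid m),
      β / B - 1 / (m : ℝ) ^ 2 - 2 * ρ < ∫ z, gain (gridFun e) h (g z.1) z ∂D := by
  unfold ApproxMulticalibrated at hgB
  push Not at hgB
  obtain ⟨h₀, hh₀, hK⟩ := hgB
  rw [K₂_eq_ofReal_sum hgm] at hK
  have hK' := lt_of_not_ge fun hle => hK.not_ge (ENNReal.ofReal_le_ofReal hle)
  obtain ⟨hh, hh1⟩ := div_sqrt_mem_unitPart hH hB hh₀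
  set h : X → ℝ := fun x => h₀ x / √B with hdef
  have hhm := hHm h hh
  have hbias : ∀ v, levelBias D g h v ^ 2 = levelBias D g h₀ v ^ 2 / B := by
    intro v
    have : levelBias D g h v = levelBias D g h₀ v / √B := by
      simp only [levelBias, hdef]
      rw [← integral_div]
      congr 1 with z
      ring
    rw [this, div_pow, Real.sq_sqrt hB.le]
  have hlt : β / B < ∑ v ∈ grid m, D.real {z | g z.1 = v} * levelBias D g h v ^ 2 := by
    rw [div_lt_iff₀ hB, Finset.sum_mul]
    refine hK'.trans_eq (Finset.sum_congr rfl fun v _ => ?_)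
    rw [hbias]
    field_simp
  -- On the grid E is the level bias, which maximizes η ↦ 2ηE - η². The value 0 elsewhere keeps |E|
  -- ≤ 1 everywhere.
  obtain ⟨e, he⟩ := exists_gridFun_near hm (E := fun v =>
    if v ∈ grid m then levelBias D g h v else 0) fun v => by
      split_ifs with hv
      · exact abs_levelBias_le D g zero_le_one hh1 (mem_Icc_of_mem_grid hv)
      · simp
  obtain ⟨h', hh', hρ⟩ := hN h ⟨hh, hh1⟩
  obtain ⟨hh'H, hh'1⟩ := hNH hh'
  have hηm := measurable_gridFun e
  have hη := abs_gridFun_le e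
  have hsI : ∀ v ∈ grid m, v ∈ Set.Icc (0 : ℝ) 1 := fun v => mem_Icc_of_mem_grid
  refine ⟨h', hh', e, ?_⟩
  have h1 : (∑ v ∈ grid m, D.real {z | g z.1 = v} * levelBias D g h v ^ 2) - 1 / (m : ℝ) ^ 2
      ≤ ∫ z, gain (gridFun e) h (g z.1) z ∂D := by
    rw [integral_gain_eq_sum D hg hgm hsI hhm hh1 hηm hη]
    have : 1 / (m : ℝ) ^ 2 = ∑ v ∈ grid m, D.real {z | g z.1 = v} * (1 / (m : ℝ)) ^ 2 := by
      rw [← Finset.sum_mul, sum_measureReal_level D hg hgm]; ring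
    rw [this, ← Finset.sum_sub_distrib]
    refine Finset.sum_le_sum fun v hv => ?_
    rw [← mul_sub]
    refine mul_le_mul_of_nonneg_left ?_ measureReal_nonneg
    have h2 := he v hv
    simp only [hv, if_true] at h2
    -- Since 2ηE - η² = E² - (η - E)², discretizing η costs at most 1/m².
    have h3 : (gridFun e v - levelBias D g h v) ^ 2 ≤ (1 / (m : ℝ)) ^ 2 := by
      rw [← sq_abs]; gcongr
    nlinarith
  have i1 := integrable_of_mem_Icc D (measurable_gain_comp hηm hhm hg)
    fun z => gain_mem_Icc hη hh1 (hsI _ (hgm _)) z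
  have i2 := integrable_of_mem_Icc D (measurable_gain_comp hηm (hHm _ hh'H) hg)
    fun z => gain_mem_Icc hη hh'1 (hsI _ (hgm _)) z
  have h2 : ∫ z, gain (gridFun e) h (g z.1) z ∂D - ∫ z, gain (gridFun e) h' (g z.1) z ∂D
      ≤ 2 * ρ := by
    rw [← integral_sub i1 i2]
    have i3 : Integrable (fun z : Example X => |h z.1 - h' z.1|) D :=
      integrable_of_mem_Icc D (a := 0) (b := 2)
        ((hhm.comp measurable_fst).sub ((hHm _ hh'H).comp measurable_fst)).abs fun z =>
        ⟨abs_nonneg _, (abs_sub _ _).trans (by linarith [hh1 z.1, hh'1 z.1])⟩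
    calc _ ≤ ∫ z, 2 * |h z.1 - h' z.1| ∂D :=
          integral_mono (i1.sub i2) (i3.const_mul 2) fun z =>
            (le_abs_self _).trans (abs_gain_sub_gain_le hη h h' (hsI _ (hgm _)) z)
      _ ≤ 2 * ρ := by rw [integral_const_mul]; linarith
  linarith

/-! ### Finite L¹-nets by packing -/

/-- Where the roundings agree, h and h' differ by at most 2/m ≤ ρ/2, and elsewhere by at most 2. A
mean distance above ρ thus forces disagreement with probability at least ρ/4. -/
theorem measureReal_round_eq_le {m : ℕ} (hm : 0 < m) (D : Measure (Example X))
    [IsProbabilityMeasure D] {ρ : ℝ} (hmρ : 4 ≤ m * ρ) {h h' : X → ℝ} (hh : Measurable h)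
    (hh' : Measurable h') (hh1 : ∀ x, |h x| ≤ 1) (hh'1 : ∀ x, |h' x| ≤ 1)
    (hρ : ρ < ∫ z, |h z.1 - h' z.1| ∂D) :
    D.real {z | roundTo m ((h z.1 + 1) / 2) = roundTo m ((h' z.1 + 1) / 2)} ≤ 1 - ρ / 4 := by
  have hm' : (0 : ℝ) < m := by exact_mod_cast hm
  set E : Set (Example X) := {z | roundTo m ((h z.1 + 1) / 2) = roundTo m ((h' z.1 + 1) / 2)}
  have hE : MeasurableSet E := measurableSet_eq_fun
    ((measurable_roundTo m).comp (((hh.comp measurable_fst).add_const 1).div_const 2))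
    ((measurable_roundTo m).comp (((hh'.comp measurable_fst).add_const 1).div_const 2))
  have hle : ∫ z, |h z.1 - h' z.1| ∂D ≤ ∫ z, (ρ / 2 + Eᶜ.indicator (fun _ => (2 : ℝ)) z) ∂D := by
    refine integral_mono (integrable_of_mem_Icc D (a := 0) (b := 2)
        ((hh.comp measurable_fst).sub (hh'.comp measurable_fst)).abs fun z =>
        ⟨abs_nonneg _, (abs_sub _ _).trans (by linarith [hh1 z.1, hh'1 z.1])⟩)
      ((integrable_const _).add ((integrable_const _).indicator hE.compl)) fun z => ?_
    have a1 := abs_le.1 (hh1 z.1)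
    have a2 := abs_le.1 (hh'1 z.1)
    have h4 : 1 / (2 * (m : ℝ)) ≤ ρ / 8 := by
      rw [div_le_iff₀ (by positivity)]; linarith
    have h0 : 0 ≤ 1 / (2 * (m : ℝ)) := by positivity
    by_cases hz : z ∈ E
    · have hz' : roundTo m ((h z.1 + 1) / 2) = roundTo m ((h' z.1 + 1) / 2) := hz
      have b1 := abs_le.1 (abs_sub_roundTo_le_inv hm (z := (h z.1 + 1) / 2)
        ⟨by linarith [a1.1], by linarith [a1.2]⟩)
      have b2 := abs_le.1 (abs_sub_roundTo_le_inv hm (z := (h' z.1 + 1) / 2)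
        ⟨by linarith [a2.1], by linarith [a2.2]⟩)
      rw [hz'] at b1
      simp only [Set.mem_compl_iff, hz, not_true, not_false_eq_true, Set.indicator_of_notMem,
        add_zero]
      exact abs_le.2 ⟨by linarith [b1.1, b2.2], by linarith [b1.2, b2.1]⟩
    · simp only [Set.mem_compl_iff, hz, not_false_eq_true, Set.indicator_of_mem]
      have : |h z.1 - h' z.1| ≤ 2 := abs_le.2 ⟨by linarith, by linarith⟩
      linarith
  rw [integral_add (integrable_const _) ((integrable_const _).indicator hE.compl),
    integral_indicator hE.compl] at hle
  simp only [integral_const, measureReal_restrict_apply_univ, probReal_univ, smul_eq_mul,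
    probReal_compl_eq_one_sub hE] at hle
  linarith

/-- Separated subsets of a class of finite pseudodimension are small. -/
theorem card_le_of_separated {H : Set (X → ℝ)} (hH : AffineClosed H)
    (hHm : ∀ h ∈ H, Measurable h) {d : ℕ} (hd : HasPseudodimension H d) {m : ℕ} (hm : 0 < m)
    (D : Measure (Example X)) [IsProbabilityMeasure D] {ρ : ℝ} (hρ : ρ ≤ 4)
    (hmρ : 4 ≤ m * ρ) {n : ℕ}
    (hn : (((n * m + 1) ^ d + 1 : ℕ) : ℝ) ^ 2 * Real.exp (-(ρ / 4 * n)) < 1)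
    {S : Finset (X → ℝ)} (hSH : ↑S ⊆ unitPart H)
    (hS : ∀ h ∈ S, ∀ h' ∈ S, h ≠ h' → ρ < ∫ z, |h z.1 - h' z.1| ∂D) :
    S.card ≤ (n * m + 1) ^ d := by
  classical
  obtain ⟨N₀, hN₀⟩ : ∃ N₀, (n * m + 1) ^ d = N₀ := ⟨_, rfl⟩
  rw [hN₀] at hn ⊢
  by_contra hcard
  -- One element more than the trace count gives a contradiction: with positive probability n random
  -- points give all members of R different rounded traces. Fixing the size of R bounds the number
  -- of pairs in the union bound.
  obtain ⟨R, hRS, hR⟩ : ∃ R ⊆ S, R.card = N₀ + 1 :=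
    Finset.exists_subset_card_eq (Nat.lt_of_not_le hcard)
  set r : (X → ℝ) → X → ℝ := fun h x => roundTo m ((h x + 1) / 2) with hr
  set P : Measure (Fin n → Example X) := Measure.pi fun _ => D
  have hpair : ∀ q ∈ R.offDiag,
      P.real {z | ∀ i, r q.1 (z i).1 = r q.2 (z i).1} ≤ Real.exp (-(ρ / 4 * n)) := by
    intro q hq
    obtain ⟨h1, h2, hne⟩ := Finset.mem_offDiag.1 hq
    have e : {z : Fin n → Example X | ∀ i, r q.1 (z i).1 = r q.2 (z i).1} =
        Set.univ.pi fun _ => {z : Example X | r q.1 z.1 = r q.2 z.1} := by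
      ext z; simp
    have hle := measureReal_round_eq_le hm D hmρ (hHm _ (hSH (hRS h1)).1)
      (hHm _ (hSH (hRS h2)).1) (hSH (hRS h1)).2 (hSH (hRS h2)).2
      (hS _ (hRS h1) _ (hRS h2) hne)
    rw [e, Measure.real, Measure.pi_pi, ENNReal.toReal_prod, Finset.prod_const, Finset.card_univ,
      Fintype.card_fin]
    calc _ ≤ (1 - ρ / 4) ^ n := by gcongr; exact hle
      _ ≤ Real.exp (-(ρ / 4)) ^ n := by
          gcongr
          · linarith
          · have := Real.add_one_le_exp (-(ρ / 4)); linarith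
      _ = _ := by rw [← Real.exp_nat_mul]; ring_nf
  have hunion : P.real (⋃ q ∈ R.offDiag, {z | ∀ i, r q.1 (z i).1 = r q.2 (z i).1}) < 1 := by
    calc _ ≤ ∑ q ∈ R.offDiag, P.real {z | ∀ i, r q.1 (z i).1 = r q.2 (z i).1} :=
          measureReal_biUnion_finset_le _ _
      _ ≤ ∑ q ∈ R.offDiag, Real.exp (-(ρ / 4 * n)) := Finset.sum_le_sum hpair
      _ = R.offDiag.card * Real.exp (-(ρ / 4 * n)) := by simp
      _ ≤ (R.card : ℝ) ^ 2 * Real.exp (-(ρ / 4 * n)) := by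
          gcongr
          rw [Finset.offDiag_card, sq]
          exact_mod_cast Nat.sub_le _ _
      _ < 1 := by rw [hR]; exact hn
  obtain ⟨z, hz⟩ : ∃ z : Fin n → Example X, z ∉ ⋃ q ∈ R.offDiag, {z | ∀ i, r q.1 (z i).1 = r q.2 (z i).1} := by
    by_contra! hall
    rw [Set.eq_univ_of_forall hall] at hunion
    simp [P] at hunion
  obtain ⟨Q, hQ, hQm⟩ := exists_finset_round_traces hd hH hm fun i => (z i).1
  have hmem : ∀ h ∈ R, (fun i => r h (z i).1) ∈ Q := by
    intro h hh
    have e : (fun x => (h x + 1) / 2) = fun x => 1 / 2 * h x + 1 / 2 := by funext x; ring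
    have h1 : (fun x => (h x + 1) / 2) ∈ H := by
      rw [e]
      exact hH h (hSH (hRS hh)).1 (1 / 2) (1 / 2)
    have h2 := hQm _ h1
    exact h2
  have hinj : R.card ≤ Q.card := by
    refine Finset.card_le_card_of_injOn (fun h i => r h (z i).1) hmem ?_
    · intro h hh h' hh' he
      by_contra hne
      refine hz (Set.mem_iUnion₂.2 ⟨(h, h'), Finset.mem_offDiag.2 ⟨hh, hh', hne⟩, fun i => ?_⟩)
      exact congrFun he i
  rw [Fintype.card_fin, hN₀] at hQ
  omega

/-- A separated set of maximal size is a net, since a function farther than ρ from all its elements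
could be adjoined. -/
theorem exists_finset_net {H : Set (X → ℝ)} (hH : AffineClosed H)
    (hHm : ∀ h ∈ H, Measurable h) {d : ℕ} (hd : HasPseudodimension H d) {m : ℕ} (hm : 0 < m)
    (D : Measure (Example X)) [IsProbabilityMeasure D] {ρ : ℝ} (hρ : ρ ≤ 4) (hmρ : 4 ≤ m * ρ)
    {n : ℕ} (hn : (((n * m + 1) ^ d + 1 : ℕ) : ℝ) ^ 2 * Real.exp (-(ρ / 4 * n)) < 1) :
    ∃ N : Finset (X → ℝ), ↑N ⊆ unitPart H ∧ N.card ≤ (n * m + 1) ^ d ∧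
      ∀ h ∈ unitPart H, ∃ h' ∈ N, ∫ z, |h z.1 - h' z.1| ∂D ≤ ρ := by
  classical
  have hm' : (0 : ℝ) < m := by exact_mod_cast hm
  have hρ0 : 0 < ρ := by
    by_contra hneg
    have := mul_nonpos_of_nonneg_of_nonpos hm'.le (not_lt.1 hneg)
    linarith
  set K : Set ℕ := {k | ∃ S : Finset (X → ℝ), S.card = k ∧ ↑S ⊆ unitPart H ∧
    ∀ h ∈ S, ∀ h' ∈ S, h ≠ h' → ρ < ∫ z, |h z.1 - h' z.1| ∂D} with hK
  have hKb : ∀ k ∈ K, k ≤ (n * m + 1) ^ d := by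
    rintro k ⟨S, rfl, h1, h2⟩
    exact card_le_of_separated hH hHm hd hm D hρ hmρ hn h1 h2
  have hK0 : K.Nonempty := ⟨0, ∅, by simp⟩
  obtain ⟨N, hNk, hNH, hNs⟩ := Nat.sSup_mem hK0 ⟨_, hKb⟩
  refine ⟨N, hNH, hNk.trans_le (hKb _ (Nat.sSup_mem hK0 ⟨_, hKb⟩)), fun h hh => ?_⟩
  by_contra! hfar
  have hnot : h ∉ N := fun hmem => by
    have := hfar h hmem
    simp at this
    linarith
  have hmem : N.card + 1 ∈ K := by
    refine ⟨insert h N, Finset.card_insert_of_notMem hnot, ?_, ?_⟩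
    · rw [Finset.coe_insert]; exact Set.insert_subset hh hNH
    · intro h₁ h₁N h₂ h₂N hne
      rcases Finset.mem_insert.1 h₁N with rfl | h₁N
      · rcases Finset.mem_insert.1 h₂N with rfl | h₂N
        · exact absurd rfl hne
        · exact hfar _ h₂N
      · rcases Finset.mem_insert.1 h₂N with rfl | h₂N
        · simpa only [abs_sub_comm] using hfar h₁ ‹_›
        · exact hNs _ h₁N _ h₂N hne
  have := le_csSup ⟨_, hKb⟩ hmem
  omega

end Measure

/-! ### Random signs and symmetrization -/

/-- Hoeffding's inequality for random signs, as a count of sign vectors. -/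
theorem card_signs_le {n : ℕ} {a : Fin n → ℝ} {r c : ℝ} (hr : 0 < r) (ha : ∀ j, |a j| ≤ r)
    (hc : 0 ≤ c) :
    ((Finset.univ.filter fun s : Fin n → Bool =>
      n * c ≤ ∑ j, if s j then -a j else a j).card : ℝ)
      ≤ 2 ^ n * Real.exp (-(n * c ^ 2 / (2 * r ^ 2))) := by
  -- This parameter minimizes the exponent l²r²/2 - lc per coordinate.
  set l : ℝ := c / r ^ 2 with hl
  have hl0 : 0 ≤ l := by positivity
  have h1 : ((Finset.univ.filter fun s : Fin n → Bool =>
      n * c ≤ ∑ j, if s j then -a j else a j).card : ℝ) * Real.exp (l * (n * c))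
      ≤ ∑ s : Fin n → Bool, Real.exp (l * ∑ j, if s j then -a j else a j) := by
    rw [← nsmul_eq_mul, ← Finset.sum_const]
    refine (Finset.sum_le_sum fun s hs => ?_).trans
      (Finset.sum_le_sum_of_subset_of_nonneg (Finset.filter_subset _ _)
        fun _ _ _ => (Real.exp_pos _).le)
    exact Real.exp_le_exp.2 (mul_le_mul_of_nonneg_left (Finset.mem_filter.1 hs).2 hl0)
  have h2 : ∑ s : Fin n → Bool, Real.exp (l * ∑ j, if s j then -a j else a j)
      = ∏ j, (2 * Real.cosh (l * a j)) := by
    have h3 : ∀ j, 2 * Real.cosh (l * a j)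
        = ∑ b : Bool, Real.exp (l * if b then -a j else a j) := by
      intro j
      rw [Fintype.sum_bool, Real.cosh_eq]
      simp
      ring
    simp_rw [h3, Finset.prod_univ_sum, Fintype.piFinset_univ, Finset.mul_sum, Real.exp_sum]
  have h4 : ∏ j, (2 * Real.cosh (l * a j)) ≤ ∏ _j : Fin n, (2 * Real.exp (l ^ 2 * r ^ 2 / 2)) := by
    refine Finset.prod_le_prod (fun j _ => by positivity) fun j _ => ?_
    refine mul_le_mul_of_nonneg_left ((Real.cosh_le_exp_half_sq _).trans ?_) zero_le_two
    refine Real.exp_le_exp.2 ?_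
    have : a j ^ 2 ≤ r ^ 2 := by rw [← sq_abs]; gcongr; exact ha j
    rw [mul_pow]
    gcongr
  rw [Finset.prod_const, Finset.card_univ, Fintype.card_fin, mul_pow, ← Real.exp_nat_mul] at h4
  have h5 := h1.trans (h2.le.trans h4)
  rw [← le_div_iff₀ (Real.exp_pos _), mul_div_assoc, ← Real.exp_sub] at h5
  refine h5.trans_eq ?_
  congr 2
  rw [hl]
  field_simp
  ring

section Symmetrization

variable {Z : Type*} [MeasurableSpace Z] {n : ℕ}

/-- Exchange the coordinates selected by `s` between two samples. -/
def swapSamples (s : Fin n → Bool) (ω : (Fin n → Z) × (Fin n → Z)) :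
    (Fin n → Z) × (Fin n → Z) :=
  (fun j => if s j then ω.2 j else ω.1 j, fun j => if s j then ω.1 j else ω.2 j)

/-- Two samples form n independent pairs, and exchanging the entries of a pair preserves μ × μ. -/
theorem measurePreserving_swapSamples (μ : Measure Z) [IsProbabilityMeasure μ]
    (s : Fin n → Bool) :
    MeasurePreserving (swapSamples s)
      ((Measure.pi fun _ : Fin n => μ).prod (Measure.pi fun _ : Fin n => μ))
      ((Measure.pi fun _ : Fin n => μ).prod (Measure.pi fun _ : Fin n => μ)) := by
  have e := measurePreserving_arrowProdEquivProdArrow Z Z (Fin n) (fun _ => μ) (fun _ => μ)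
  have h1 : MeasurePreserving
      (fun (a : Fin n → Z × Z) j => (if s j then Prod.swap else id) (a j))
      (Measure.pi fun _ : Fin n => μ.prod μ) (Measure.pi fun _ : Fin n => μ.prod μ) := by
    refine measurePreserving_pi _ _ fun j => ?_
    split_ifs
    · exact Measure.measurePreserving_swap
    · exact MeasurePreserving.id _
  have h2 := (e.comp h1).comp (e.symm)
  convert h2 using 1
  funext ω
  refine Prod.ext (funext fun j => ?_) (funext fun j => ?_) <;>
  · by_cases hs : s j <;>
    simp [swapSamples, MeasurableEquiv.arrowProdEquivProdArrow,
      Equiv.arrowProdEquivProdArrow, hs]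

/-- Each swap preserves the product measure, so 2^n P(W) is the mean number of swaps that carry a
pair of samples into W. -/
theorem measureReal_le_of_card_swap_le (μ : Measure Z) [IsProbabilityMeasure μ]
    {W : Set ((Fin n → Z) × (Fin n → Z))} (hW : MeasurableSet W) {K : ℝ}
    (hK : ∀ ω, ∀ T : Finset (Fin n → Bool), (∀ s ∈ T, swapSamples s ω ∈ W) →
      (T.card : ℝ) ≤ 2 ^ n * K) :
    ((Measure.pi fun _ : Fin n => μ).prod (Measure.pi fun _ : Fin n => μ)).real W ≤ K := by
  classical
  set P := (Measure.pi fun _ : Fin n => μ).prod (Measure.pi fun _ : Fin n => μ)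
  have hs : ∀ s : Fin n → Bool, P.real W = ∫ ω, (swapSamples s ⁻¹' W).indicator 1 ω ∂P := by
    intro s
    have hmp := measurePreserving_swapSamples (n := n) μ s
    rw [integral_indicator_one (hmp.measurable hW), hmp.measureReal_preimage hW.nullMeasurableSet]
  have hi : ∀ s : Fin n → Bool,
      Integrable (fun ω => (swapSamples s ⁻¹' W).indicator
        (1 : (Fin n → Z) × (Fin n → Z) → ℝ) ω) P := fun s =>
    (integrable_const (1 : ℝ)).indicator ((measurePreserving_swapSamples μ s).measurable hW)
  have h1 : (2 : ℝ) ^ n * P.real W ≤ 2 ^ n * K := by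
    calc (2 : ℝ) ^ n * P.real W = ∑ _s : Fin n → Bool, P.real W := by simp
      _ = ∑ s, ∫ ω, (swapSamples s ⁻¹' W).indicator 1 ω ∂P := Finset.sum_congr rfl fun s _ => hs s
      _ = ∫ ω, ∑ s, (swapSamples s ⁻¹' W).indicator 1 ω ∂P :=
          (integral_finsetSum _ fun s _ => hi s).symm
      _ ≤ ∫ _, (2 : ℝ) ^ n * K ∂P := by
          refine integral_mono (integrable_finsetSum _ fun s _ => hi s) (integrable_const _)
            fun ω => ?_
          refine le_trans (le_of_eq ?_)
            (hK ω (Finset.univ.filter fun s => swapSamples s ω ∈ W) (by simp))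
          simp [Set.indicator_apply]
      _ = 2 ^ n * K := by simp
  exact le_of_mul_le_mul_left h1 (by positivity)

/-- A bounded function of mean at least `τ + σ` has sample average at least `τ` half the time. -/
theorem half_le_measureReal_sum_ge (μ : Measure Z) [IsProbabilityMeasure μ] {G : Z → ℝ}
    (hG : Measurable G) (hGI : ∀ z, G z ∈ Set.Icc (-3 : ℝ) 2) {τ σ : ℝ} (hσ : 0 < σ)
    (hn : 25 ≤ 2 * (n * σ ^ 2)) (hm : τ + σ ≤ ∫ z, G z ∂μ) :
    1 / 2 ≤ (Measure.pi fun _ : Fin n => μ).real {S | n * τ ≤ ∑ j, G (S j)} := by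
  have hn0 : (0 : ℝ) < n := by
    by_contra h
    have : (n : ℝ) * σ ^ 2 ≤ 0 := mul_nonpos_of_nonpos_of_nonneg (not_lt.1 h) (sq_nonneg _)
    linarith
  set P := Measure.pi fun _ : Fin n => μ
  have hL : MemLp G 2 μ := memLp_of_bounded (ae_of_all _ hGI) hG.aestronglyMeasurable 2
  set Y : (Fin n → Z) → ℝ := ∑ j, fun S => G (S j) with hY
  have hYapp : ∀ S, Y S = ∑ j, G (S j) := fun S => by simp [hY]
  have hGj : ∀ j : Fin n, Measurable fun S : Fin n → Z => G (S j) :=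
    fun j => hG.comp (measurable_pi_apply j)
  have hLj : ∀ j : Fin n, MemLp (fun S : Fin n → Z => G (S j)) 2 P := fun j =>
    hL.comp_measurePreserving (measurePreserving_eval _ j)
  have hYL : MemLp Y 2 P := memLp_finsetSum' _ fun j _ => hLj j
  have hvar : Var[Y; P] ≤ n * (25 / 4) := by
    rw [hY, variance_sum_pi (μ := fun _ : Fin n => μ) (X := fun _ => G) fun _ => hL]
    have := variance_le_sq_of_bounded (μ := μ) (ae_of_all _ hGI) hG.aemeasurable
    simp only [Finset.sum_const, Finset.card_univ, Fintype.card_fin, nsmul_eq_mul]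
    gcongr
    linarith
  have hmean : P[Y] = n * ∫ z, G z ∂μ := by
    have : P[Y] = ∑ j : Fin n, ∫ S, G (S j) ∂P := by
      simp_rw [hYapp]
      exact integral_finsetSum _ fun j _ => (hLj j).integrable (by norm_num)
    rw [this]
    have h2 : ∀ j : Fin n, ∫ S, G (S j) ∂P = ∫ z, G z ∂μ := fun j => by
      have := integral_comp_eval (μ := fun _ : Fin n => μ) (i := j) (f := G)
        hG.aestronglyMeasurable
      exact this
    simp [h2]
  -- Chebyshev at deviation nσ: the variance bound n · 25/4 is at most half of (nσ)² when 25 ≤ 2nσ².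
  have hcheb := meas_ge_le_variance_div_sq (μ := P) hYL (c := n * σ) (by positivity)
  have hcheb' : P.real {S | n * σ ≤ |Y S - P[Y]|} ≤ 1 / 2 := by
    rw [Measure.real]
    refine ENNReal.toReal_le_of_le_ofReal (by norm_num) (hcheb.trans ?_)
    refine ENNReal.ofReal_le_ofReal ?_
    rw [div_le_iff₀ (by positivity)]
    nlinarith
  have hms : MeasurableSet {S : Fin n → Z | n * τ ≤ ∑ j, G (S j)} :=
    measurableSet_le measurable_const (Finset.measurable_fun_sum _ fun j _ => hGj j)
  have hsub : {S : Fin n → Z | n * τ ≤ ∑ j, G (S j)}ᶜ ⊆ {S | n * σ ≤ |Y S - P[Y]|} := by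
    intro S hS
    have h1 : ∑ j, G (S j) < n * τ := not_le.1 hS
    show n * σ ≤ |Y S - P[Y]|
    rw [abs_sub_comm, hmean, hYapp]
    refine le_trans ?_ (le_abs_self _)
    nlinarith [mul_le_mul_of_nonneg_left hm hn0.le]
  have h3 := (measureReal_mono hsub (μ := P)).trans hcheb'
  rw [probReal_compl_eq_one_sub hms] at h3
  linarith

/-- Symmetrization: if each bad sample is exposed by half of the ghost samples, then few samples
are bad. The set of bad samples need not be measurable. -/
theorem one_sub_le_measureReal_of_ghost (μ : Measure Z) [IsProbabilityMeasure μ]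
    {good : Set (Fin n → Z)} {W : Set ((Fin n → Z) × (Fin n → Z))} (hW : MeasurableSet W)
    (hghost : ∀ S, S ∉ good → 1 / 2 ≤ (Measure.pi fun _ : Fin n => μ).real {S' | (S, S') ∈ W})
    {K : ℝ} (hK : ∀ ω, ∀ T : Finset (Fin n → Bool), (∀ s ∈ T, swapSamples s ω ∈ W) →
      (T.card : ℝ) ≤ 2 ^ n * K) :
    1 - 2 * K ≤ (Measure.pi fun _ : Fin n => μ).real good := by
  set P := Measure.pi fun _ : Fin n => μ
  have hW' := measureReal_le_of_card_swap_le μ hW hK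
  have hK0 : 0 ≤ K := measureReal_nonneg.trans hW'
  set φ : (Fin n → Z) → ℝ≥0∞ := fun S => P (Prod.mk S ⁻¹' W) with hφ
  have hφm : Measurable φ := measurable_measure_prodMk_left hW
  -- This is a measurable superset of the complement of `good`, to which Markov's inequality
  -- applies.
  set bad : Set (Fin n → Z) := {S | 1 / 2 ≤ φ S} with hbad
  have hbm : MeasurableSet bad := measurableSet_le measurable_const hφm
  have h1 : 1 / 2 * P bad ≤ (P.prod P) W := by
    rw [Measure.prod_apply hW]
    exact mul_meas_ge_le_lintegral hφm _
  have h2 : P.real bad ≤ 2 * K := by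
    have h3 := ENNReal.toReal_mono (measure_ne_top _ _) h1
    rw [ENNReal.toReal_mul] at h3
    have h4 : (1 / 2 : ℝ≥0∞).toReal = 1 / 2 := by simp
    rw [h4] at h3
    have h5 : ((P.prod P) W).toReal ≤ K := hW'
    have h6 : (P bad).toReal = P.real bad := rfl
    linarith
  have hsub : badᶜ ⊆ good := by
    intro S hS
    by_contra hg
    refine hS ?_
    have := hghost S hg
    show 1 / 2 ≤ P (Prod.mk S ⁻¹' W)
    rw [← ofReal_measureReal (μ := P) (s := Prod.mk S ⁻¹' W)]
    have h7 : (1 / 2 : ℝ≥0∞) = ENNReal.ofReal (1 / 2) := by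
      rw [ENNReal.ofReal_div_of_pos (by norm_num)]; simp
    rw [h7]
    exact ENNReal.ofReal_le_ofReal this
  have h8 := measureReal_mono hsub (μ := P)
  rw [probReal_compl_eq_one_sub hbm] at h8
  linarith

end Symmetrization

/-! ### Elementary bounds for the dimension and the sample size -/

/-- A single point is shattered by the constants ±1, which affine closure provides. -/
theorem one_le_of_hasPseudodimension {H : Set (X → ℝ)} (hH : AffineClosed H) {h : X → ℝ}
    (hh : h ∈ H) (x : X) {d : ℕ} (hd : HasPseudodimension H d) : 1 ≤ d := by
  refine hd.2 ⟨fun _ => x, fun _ => 0, fun b => ⟨_, hH h hh 0 (if b 0 then 1 else -1), fun i => ?_⟩⟩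
  rw [Subsingleton.elim i 0]
  cases hb : b 0 <;> simp

/-- `n / log n` is large when `n` is. -/
theorem mul_log_le_of_le {d b n L : ℝ} (hd : 1 ≤ d) (hb : 2 ≤ b) (hL : L = Real.log (d * b))
    (hn : 1600000 * (d * b ^ 5 * L ^ 2) ≤ n) :
    10240 * (d * b ^ 4) * Real.log (81 * n * b) ≤ n := by
  have hdb : 2 ≤ d * b := by nlinarith
  have hlog2 : Real.log 2 ≤ L := by rw [hL]; exact Real.log_le_log (by norm_num) hdb
  have hL0 : 0 < L := (Real.log_pos one_lt_two).trans_le hlog2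
  have hbL : 1 ≤ b * L := by nlinarith [Real.log_two_gt_d9]
  have hX : 0 < d * b ^ 4 := by positivity
  have h1 : 1600000 * (d * b ^ 4 * L) ≤ n := by
    refine le_trans ?_ hn
    have : d * b ^ 5 * L ^ 2 = d * b ^ 4 * L * (b * L) := by ring
    rw [this]
    have : 0 ≤ d * b ^ 4 * L := by positivity
    nlinarith
  have hn0 : 0 < n := lt_of_lt_of_le (by positivity) h1
  -- M is twice the coefficient of the logarithm, so log(n/M) ≤ n/M accounts for exactly n/2.
  set M : ℝ := 20480 * (d * b ^ 4) with hM
  have hM0 : 0 < M := by positivity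
  have h2 : Real.log (81 * n * b) = Real.log (n / M) + Real.log (81 * b * M) := by
    rw [← Real.log_mul (by positivity) (by positivity)]
    congr 1
    field_simp
  have h3 : Real.log (n / M) ≤ n / M := by
    have := Real.log_le_sub_one_of_pos (show 0 < n / M by positivity); linarith
  have h4 : Real.log (81 * b * M) ≤ 26 * L := by
    have h5 : 81 * b * M ≤ 2 ^ 21 * (d * b) ^ 5 := by
      have : d ≤ d ^ 5 := le_self_pow₀ hd (by norm_num)
      have h6 : d * b ^ 5 ≤ (d * b) ^ 5 := by rw [mul_pow]; gcongr
      calc 81 * b * M = 1658880 * (d * b ^ 5) := by rw [hM]; ring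
        _ ≤ 2 ^ 21 * (d * b) ^ 5 := by
          have : 0 ≤ d * b ^ 5 := by positivity
          nlinarith
    calc _ ≤ Real.log (2 ^ 21 * (d * b) ^ 5) := Real.log_le_log (by positivity) h5
      _ = 21 * Real.log 2 + 5 * L := by
          rw [Real.log_mul (by positivity) (by positivity), Real.log_pow, Real.log_pow, hL]
          norm_num
      _ ≤ 26 * L := by linarith
  calc _ ≤ 10240 * (d * b ^ 4) * (n / M + 26 * L) := by rw [h2]; gcongr
    _ = n / 2 + 266240 * (d * b ^ 4 * L) := by rw [hM]; field_simp; ring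
    _ ≤ n := by nlinarith

/-! ### The gap between sample and ghost sample -/

/-- The event that some gain is `c` larger on the second sample than on the first. -/
def gapEvent (N : Finset (X → ℝ)) (m n : ℕ) (c : ℝ) (g : (Fin n → Example X) → X → ℝ) :
    Set ((Fin n → Example X) × (Fin n → Example X)) :=
  {ω | ∃ h ∈ N, ∃ e : ↥(grid m) → ↥(grid m), n * c ≤
    ∑ j, (gain (gridFun e) h (g ω.1 (ω.2 j).1) (ω.2 j)
      - gain (gridFun e) h (g ω.1 (ω.1 j).1) (ω.1 j))}

/-- Few sign vectors move a pair of samples into the event that a gain generalizes badly. -/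
theorem card_swap_gapEvent_le {N : Finset (X → ℝ)} (hN : ∀ h ∈ N, ∀ x, |h x| ≤ 1) {m n : ℕ}
    {c : ℝ} (hc : 0 ≤ c) {g : (Fin n → Example X) → X → ℝ} (hg : ∀ S x, g S x ∈ Set.Icc (0 : ℝ) 1)
    {Q : ℕ} (hQ : ∀ x : Fin n ⊕ Fin n → X, ∃ P : Finset (Fin n ⊕ Fin n → ℝ), P.card ≤ Q ∧
      ∀ S, (fun i => g S (x i)) ∈ P)
    (ω : (Fin n → Example X) × (Fin n → Example X)) (T : Finset (Fin n → Bool))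
    (hT : ∀ s ∈ T, swapSamples s ω ∈ gapEvent N m n c g) :
    (T.card : ℝ) ≤ 2 ^ n *
      (Q * N.card * (m + 1) ^ (m + 1) * Real.exp (-(n * c ^ 2 / 50))) := by
  classical
  obtain ⟨P, hP, hPm⟩ := hQ (Sum.elim (fun j => (ω.1 j).1) fun j => (ω.2 j).1)
  -- P may contain patterns outside [0, 1]. Clipping keeps the gains bounded for all of them and
  -- changes no actual model.
  set clip : ℝ → ℝ := fun v => max 0 (min 1 v) with hclip
  have hclipI : ∀ v, clip v ∈ Set.Icc (0 : ℝ) 1 := fun v =>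
    ⟨le_max_left _ _, max_le zero_le_one (min_le_left _ _)⟩
  have hclip' : ∀ v ∈ Set.Icc (0 : ℝ) 1, clip v = v := fun v hv => by
    simp [hclip, hv.1, hv.2]
  set a : (Fin n ⊕ Fin n → ℝ) × (X → ℝ) × (↥(grid m) → ↥(grid m)) → Fin n → ℝ := fun q j =>
    gain (gridFun q.2.2) q.2.1 (clip (q.1 (Sum.inr j))) (ω.2 j)
      - gain (gridFun q.2.2) q.2.1 (clip (q.1 (Sum.inl j))) (ω.1 j) with ha
  set I := P ×ˢ N ×ˢ (Finset.univ : Finset (↥(grid m) → ↥(grid m))) with hI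
  -- The model varies with the swap, but its values at the 2n points form a pattern in P, which
  -- depends on the unswapped points only. For a fixed pattern, swapping index j merely flips the
  -- sign of the j-th difference.
  have hsub : T ⊆ I.biUnion fun q => Finset.univ.filter fun s : Fin n → Bool =>
      n * c ≤ ∑ j, if s j then -a q j else a q j := by
    intro s hs
    obtain ⟨h, hh, e, hle⟩ := hT s hs
    refine Finset.mem_biUnion.2 ⟨((fun i => g (swapSamples s ω).1
        (Sum.elim (fun j => (ω.1 j).1) (fun j => (ω.2 j).1) i)), h, e), ?_, Finset.mem_filter.2 ⟨Finset.mem_univ _,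
      hle.trans_eq (Finset.sum_congr rfl fun j _ => ?_)⟩⟩
    · simp only [hI, Finset.mem_product, Finset.mem_univ, and_true]
      exact ⟨hPm _, hh⟩
    · have h1 := hclip' _ (hg (swapSamples s ω).1 (ω.1 j).1)
      have h2 := hclip' _ (hg (swapSamples s ω).1 (ω.2 j).1)
      simp only [ha, Sum.elim_inl, Sum.elim_inr, h1, h2]
      by_cases hsj : s j
      · have e1 : (swapSamples s ω).1 j = ω.2 j := by simp [swapSamples, hsj]
        have e2 : (swapSamples s ω).2 j = ω.1 j := by simp [swapSamples, hsj]
        rw [e1, e2, if_pos hsj, neg_sub]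
      · have e1 : (swapSamples s ω).1 j = ω.1 j := by simp [swapSamples, hsj]
        have e2 : (swapSamples s ω).2 j = ω.2 j := by simp [swapSamples, hsj]
        rw [e1, e2, if_neg hsj]
  have hcard : I.card ≤ Q * N.card * (m + 1) ^ (m + 1) := by
    rw [hI, Finset.card_product, Finset.card_product, Finset.card_univ, Fintype.card_fun,
      Fintype.card_coe, ← mul_assoc]
    refine Nat.mul_le_mul (Nat.mul_le_mul_right _ hP) ?_
    exact (Nat.pow_le_pow_left (card_grid_le m) _).trans
      (Nat.pow_le_pow_right (Nat.succ_pos _) (card_grid_le m))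
  have hcard' : (I.card : ℝ) ≤ Q * N.card * (m + 1) ^ (m + 1) := by exact_mod_cast hcard
  calc (T.card : ℝ) ≤ ∑ q ∈ I, ((Finset.univ.filter fun s : Fin n → Bool =>
        n * c ≤ ∑ j, if s j then -a q j else a q j).card : ℝ) := by
        exact_mod_cast (Finset.card_le_card hsub).trans Finset.card_biUnion_le
    _ ≤ ∑ _q ∈ I, 2 ^ n * Real.exp (-(n * c ^ 2 / (2 * 5 ^ 2))) := by
        refine Finset.sum_le_sum fun q hq => card_signs_le (by norm_num) (fun j => ?_) hc
        have hqN : q.2.1 ∈ N := by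
          simp only [hI, Finset.mem_product] at hq; exact hq.2.1
        -- Both gains lie in [-3, 2], so their difference is at most 5 in absolute value.
        have b1 := gain_mem_Icc (abs_gridFun_le q.2.2) (hN _ hqN)
          (hclipI (q.1 (Sum.inr j))) (ω.2 j)
        have b2 := gain_mem_Icc (abs_gridFun_le q.2.2) (hN _ hqN)
          (hclipI (q.1 (Sum.inl j))) (ω.1 j)
        exact abs_le.2 ⟨by linarith [b1.1, b2.2], by linarith [b1.2, b2.1]⟩
    _ = I.card * (2 ^ n * Real.exp (-(n * c ^ 2 / 50))) := by
        rw [Finset.sum_const, nsmul_eq_mul]; norm_num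
    _ ≤ (Q * N.card * (m + 1) ^ (m + 1)) * (2 ^ n * Real.exp (-(n * c ^ 2 / 50))) := by
        gcongr
    _ = _ := by ring

section

variable [MeasurableSpace X]

theorem isProbabilityMeasure_empirical {n : ℕ} (hn : 0 < n) (S : Fin n → Example X) :
    IsProbabilityMeasure (empirical S) := by
  refine ⟨?_⟩
  simp only [empirical, Measure.smul_apply, Measure.finsetSum_apply, measure_univ,
    Finset.sum_const, Finset.card_univ, Fintype.card_fin, smul_eq_mul, nsmul_eq_mul, mul_one]
  exact ENNReal.inv_mul_cancel (by exact_mod_cast hn.ne') (ENNReal.natCast_ne_top n)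

theorem integral_empirical {n : ℕ} (S : Fin n → Example X) {G : Example X → ℝ}
    (hG : Measurable G) : ∫ z, G z ∂(empirical S) = (n : ℝ)⁻¹ * ∑ j, G (S j) := by
  rw [empirical, integral_smul_measure, integral_finsetSum_measure]
  · simp [integral_dirac' _ _ hG.stronglyMeasurable]
  · exact fun j _ => integrable_dirac' hG.stronglyMeasurable (by simp)

/-- The traces of all models that the algorithm can output. -/
theorem exists_finset_output_traces {H : Set (X → ℝ)} {d : ℕ} (hd : HasPseudodimension H d)
    (hH : AffineClosed H) (hHm : ∀ h ∈ H, Measurable h) {A : Measure (Example X) → X → ℝ}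
    (hA : IsRegressionOracle H A) {f : X → ℝ} (hf : Measurable f) {α B : ℝ} (hα : 0 < α)
    (hB : 0 < B) {ι : Type*} [Fintype ι] (x : ι → X) :
    ∃ P : Finset (ι → ℝ), P.card ≤ (gridSize α B + 1) *
        (Fintype.card ι * gridSize α B + 1) ^ (d * (gridSize α B + 1) * gridSize α B) ∧
      ∀ D : Measure (Example X), IsProbabilityMeasure D →
        (fun i => output f α A D B (x i)) ∈ P := by
  classical
  set m := gridSize α B
  choose P hP hPm using
    exists_finset_boostClass_traces hd hH (gridSize_pos hα hB) f x
  refine ⟨(Finset.range (m + 1)).biUnion P, ?_, fun D hD => ?_⟩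
  · refine Finset.card_biUnion_le.trans ?_
    calc _ ≤ ∑ _t ∈ Finset.range (m + 1), (Fintype.card ι * m + 1) ^ (d * (m + 1) * m) := by
          refine Finset.sum_le_sum fun t ht => (hP t).trans ?_
          refine Nat.pow_le_pow_right (Nat.succ_pos _) (Nat.mul_le_mul_left _ ?_)
          exact Nat.lt_succ_iff.1 (Finset.mem_range.1 ht)
      _ = _ := by simp
  · refine Finset.mem_biUnion.2 ⟨finalRound f α A D B - 1, Finset.mem_range.2 ?_, ?_⟩
    · exact Nat.lt_succ_iff.2 (finalRound_sub_one_le hA hHm hf hα hB D)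
    · exact hPm _ _ (iter_mem_boostClass hA f α D B _)

theorem measurableSet_gapEvent {N : Finset (X → ℝ)} (hN : ∀ h ∈ N, Measurable h) (m n : ℕ) (c : ℝ)
    {g : (Fin n → Example X) → X → ℝ}
    (hg : Measurable fun p : (Fin n → Example X) × X => g p.1 p.2) :
    MeasurableSet (gapEvent N m n c g) := by
  have e : gapEvent N m n c g = ⋃ h ∈ N, ⋃ e : ↥(grid m) → ↥(grid m), {ω | n * c ≤
      ∑ j, (gain (gridFun e) h (g ω.1 (ω.2 j).1) (ω.2 j)
      - gain (gridFun e) h (g ω.1 (ω.1 j).1) (ω.1 j))} := by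
    ext ω; simp [gapEvent]
  rw [e]
  refine Finset.measurableSet_biUnion _ fun h hh => MeasurableSet.iUnion fun e => ?_
  have hG := measurable_gain (measurable_gridFun e) (hN h hh)
  refine measurableSet_le measurable_const (Finset.measurable_fun_sum _ fun j _ => ?_)
  have h1 : Measurable fun ω : (Fin n → Example X) × (Fin n → Example X) => ω.1 j :=
    (measurable_pi_apply j).comp measurable_fst
  have h2 : Measurable fun ω : (Fin n → Example X) × (Fin n → Example X) => ω.2 j :=
    (measurable_pi_apply j).comp measurable_snd
  have g1 : Measurable fun ω : (Fin n → Example X) × (Fin n → Example X) => g ω.1 (ω.1 j).1 :=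
    hg.comp (measurable_fst.prodMk (measurable_fst.comp h1))
  have g2 : Measurable fun ω : (Fin n → Example X) × (Fin n → Example X) => g ω.1 (ω.2 j).1 :=
    hg.comp (measurable_fst.prodMk (measurable_fst.comp h2))
  have k1 := hG.comp (g1.prodMk h1)
  have k2 := hG.comp (g2.prodMk h2)
  exact k2.sub k1

/-- The generalization guarantee in terms of a net of `H`. -/
theorem one_sub_le_measureReal_multicalibrated {H : Set (X → ℝ)} {d : ℕ}
    (hd : HasPseudodimension H d)
    (hH : AffineClosed H) (hHm : ∀ h ∈ H, Measurable h) {A : Measure (Example X) → X → ℝ}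
    (hA : IsRegressionOracle H A) {f : X → ℝ} (hf : Measurable f) {α B : ℝ} (hα : 0 < α)
    (hB : 2 * α ≤ B) (μ : Measure (Example X)) [IsProbabilityMeasure μ] {n : ℕ}
    (hn : 128 * (B / α) ^ 2 ≤ n)
    (hout : Measurable fun p : (Fin n → Example X) × X => output f α A (empirical p.1) B p.2)
    {N : Finset (X → ℝ)} (hNH : ↑N ⊆ unitPart H)
    (hN : ∀ h ∈ unitPart H, ∃ h' ∈ N, ∫ z, |h z.1 - h' z.1| ∂μ ≤ α / (16 * B)) :
    1 - 2 * ((((gridSize α B + 1) *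
        (2 * n * gridSize α B + 1) ^ (d * (gridSize α B + 1) * gridSize α B) : ℕ) : ℝ) *
        N.card * (gridSize α B + 1) ^ (gridSize α B + 1) *
        Real.exp (-(n * (5 / (16 * (B / α))) ^ 2 / 50)))
      ≤ (Measure.pi fun _ : Fin n => μ).real {S | ApproxMulticalibrated (2 * α) μ
        (boundedPart H B) (output f α A (empirical S) B)} := by
  have hB0 : 0 < B := by linarith
  set b := B / α with hb
  have hb2 : 2 ≤ b := by rw [hb, le_div_iff₀ hα]; exact hB
  have hb0 : 0 < b := by linarith
  have hn0 : 0 < n := by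
    have : (0 : ℝ) < n := lt_of_lt_of_le (by positivity) hn
    exact_mod_cast this
  have hn0' : (0 : ℝ) < n := by exact_mod_cast hn0
  have hm := gridSize_pos hα hB0
  have hm' : (0 : ℝ) < gridSize α B := by exact_mod_cast hm
  have hmb : 2 * b ≤ gridSize α B := by
    rw [hb, ← mul_div_assoc]; exact Nat.le_ceil _
  have hgrid : ∀ (S : Fin n → Example X) x, output f α A (empirical S) B x
      ∈ grid (gridSize α B) := fun S x => iter_mem_grid _ _ _ _ _ _ _
  have hgI := fun S x => mem_Icc_of_mem_grid (hgrid S x)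
  have hom : ∀ S : Fin n → Example X, Measurable (output f α A (empirical S) B) :=
    fun S => measurable_iter hA hHm hf α _ B _
  have e1 : α / (2 * B) = 1 / (2 * b) := by rw [hb]; field_simp
  have e2 : α / (16 * B) = 1 / (16 * b) := by rw [hb]; field_simp
  have e3 : 2 * α / B = 2 / b := by rw [hb]; field_simp
  refine one_sub_le_measureReal_of_ghost μ
    (W := gapEvent N (gridSize α B) n (5 / (16 * b)) fun S => output f α A (empirical S) B)
    (measurableSet_gapEvent (fun h hh => hHm h (hNH hh).1) _ _ _ hout) (fun S hS => ?_)
    (card_swap_gapEvent_le (fun h hh => (hNH hh).2) (by positivity) hgI fun x => ?_)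
  · set g := output f α A (empirical S) B with hgdef
    have hprob := isProbabilityMeasure_empirical hn0 S
    obtain ⟨h, hh, e, hlt⟩ := exists_lt_integral_gain hH hHm hm (hom S) (hgrid S) μ hB0 hS hNH hN
    have hhH := hNH hh
    have hGm := measurable_gain_comp (measurable_gridFun e) (hHm h hhH.1) (hom S)
    have hin := integral_gain_output_le hA hHm hH hf hα hB0 (empirical S) (measurable_gridFun e)
      (abs_gridFun_le e) hhH.1 hhH.2
    rw [integral_empirical S hGm, inv_mul_le_iff₀ hn0', e1] at hin
    have hr1 : 5 / (4 * (gridSize α B : ℝ)) ≤ 5 / (8 * b) := by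
      exact div_le_div_of_nonneg_left (by norm_num) (by positivity) (by linarith)
    have hr2 : 1 / (gridSize α B : ℝ) ^ 2 ≤ 1 / (8 * b) := by
      refine one_div_le_one_div_of_le (by positivity) ?_
      calc 8 * b ≤ (2 * b) ^ 2 := by nlinarith
        _ ≤ _ := by gcongr
    -- The population gain exceeds 28/(16b), and the sample gain is at most 18/(16b). Half of the
    -- margin 10/(16b) is spent on Chebyshev for the ghost sample; the other half is the gap in W.
    have hlow : 23 / (16 * b) + 5 / (16 * b)
        ≤ ∫ z, gain (gridFun e) h (g z.1) z ∂μ := by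
      refine le_trans ?_ hlt.le
      rw [e2, e3]
      have : 23 / (16 * b) + 5 / (16 * b) = 2 / b - 1 / (8 * b) - 2 * (1 / (16 * b)) := by
        field_simp; norm_num
      linarith
    have hσ : 25 ≤ 2 * (n * (5 / (16 * b)) ^ 2) := by
      have : 2 * (n * (5 / (16 * b)) ^ 2) = 25 * (n / (128 * b ^ 2)) := by
        field_simp; norm_num
      rw [this]
      have : 1 ≤ n / (128 * b ^ 2) := (one_le_div (by positivity)).2 hn
      linarith
    refine (half_le_measureReal_sum_ge (n := n) μ hGm (fun z => gain_mem_Icc (abs_gridFun_le e)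
      hhH.2 (hgI S z.1) z) (by positivity) hσ hlow).trans (measureReal_mono fun S' hS' => ?_)
    refine ⟨h, hh, e, ?_⟩
    have h1 : n * (23 / (16 * b)) ≤ ∑ j, gain (gridFun e) h (g (S' j).1) (S' j) := hS'
    have h2 : ∑ j, gain (gridFun e) h (g (S j).1) (S j) ≤ n * (9 / (8 * b)) := by
      refine hin.trans (mul_le_mul_of_nonneg_left ?_ hn0'.le)
      have : 9 / (8 * b) = 1 / (2 * b) + 5 / (8 * b) := by field_simp; norm_num
      linarith
    have h3 : n * (5 / (16 * b)) = n * (23 / (16 * b)) - n * (9 / (8 * b)) := by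
      field_simp; norm_num
    show n * (5 / (16 * b)) ≤ ∑ j, (gain (gridFun e) h (g (S' j).1) (S' j)
      - gain (gridFun e) h (g (S j).1) (S j))
    rw [Finset.sum_sub_distrib]
    linarith
  · obtain ⟨P, hP, hPm⟩ := exists_finset_output_traces hd hH hHm hA hf hα hB0 x
    refine ⟨P, hP.trans_eq ?_, fun S => hPm _ (isProbabilityMeasure_empirical hn0 S)⟩
    rw [Fintype.card_sum, Fintype.card_fin, two_mul]

end

/-! ### Arithmetic of the union bounds -/

/-- The union bound over the net, the traces and the increments is beaten by the tail bound. -/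
theorem union_bound_le {d m n N : ℕ} {b δ : ℝ} (hd : 1 ≤ d) (hb : 2 ≤ b) (hδ : 0 < δ)
    (hmb : (m : ℝ) ≤ 5 / 2 * b) (hm : 1 ≤ m) (hn0 : 1 ≤ n)
    (hn : 10240 * (d * b ^ 4) * Real.log (n * (32 * m) + 1) ≤ n)
    (hnδ : 1024 * b ^ 2 * Real.log (1 / δ) ≤ n) (hN : N ≤ (n * (32 * m) + 1) ^ d) :
    (((m + 1) * (2 * n * m + 1) ^ (d * (m + 1) * m) : ℕ) : ℝ) * N * (m + 1) ^ (m + 1) *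
      Real.exp (-(n * (5 / (16 * b)) ^ 2 / 50)) ≤ δ := by
  have hb0 : 0 < b := by linarith
  have hd' : (1 : ℝ) ≤ d := by exact_mod_cast hd
  have hm' : (1 : ℝ) ≤ m := by exact_mod_cast hm
  have hn' : (1 : ℝ) ≤ n := by exact_mod_cast hn0
  set M : ℝ := n * (32 * m) + 1 with hM
  have hM0 : 0 < M := by positivity
  have hM1 : 1 ≤ M := by rw [hM]; nlinarith
  set l := Real.log M with hl
  have hl0 : 0 ≤ l := Real.log_nonneg hM1
  have hmM : (m : ℝ) + 1 ≤ M := by rw [hM]; nlinarith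
  have hnM : 2 * (n : ℝ) * m + 1 ≤ M := by rw [hM]; nlinarith
  have hN' : (N : ℝ) ≤ M ^ d := by rw [hM]; exact_mod_cast hN
  -- The four terms account for the halting time, the traces, the net and the increments. Each base
  -- is at most M.
  set k : ℕ := 1 + d * (m + 1) * m + d + (m + 1) with hk
  have h1 : (((m + 1) * (2 * n * m + 1) ^ (d * (m + 1) * m) : ℕ) : ℝ) * N * (m + 1) ^ (m + 1)
      ≤ M ^ k := by
    push_cast
    calc _ ≤ M * M ^ (d * (m + 1) * m) * M ^ d * M ^ (m + 1) := by gcongr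
      _ = M ^ k := by rw [hk]; ring
  have h2 : M ^ k = Real.exp (k * l) := by rw [Real.exp_nat_mul, hl, Real.exp_log hM0]
  have hk' : (k : ℝ) ≤ 10 * (d * b ^ 2) := by
    rw [hk]
    push_cast
    have a1 : ((m : ℝ) + 1) ≤ 3 * b := by linarith
    have a2 : ((m : ℝ) + 1) * m ≤ 3 * b * (5 / 2 * b) := by gcongr
    have a3 : (d : ℝ) * (m + 1) * m ≤ d * (15 / 2 * b ^ 2) := by
      rw [mul_assoc]; exact mul_le_mul_of_nonneg_left (by linarith) (by positivity)
    have a4 : b ≤ b ^ 2 / 2 := by nlinarith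
    have a5 : b ^ 2 ≤ d * b ^ 2 := le_mul_of_one_le_left (by positivity) hd'
    have a6 : (4 : ℝ) * d ≤ d * b ^ 2 := by nlinarith
    nlinarith
  have h3 : (k : ℝ) * l ≤ n / (1024 * b ^ 2) := by
    rw [le_div_iff₀ (by positivity)]
    calc (k : ℝ) * l * (1024 * b ^ 2) ≤ 10 * (d * b ^ 2) * l * (1024 * b ^ 2) := by gcongr
      _ = 10240 * (d * b ^ 4) * l := by ring
      _ ≤ n := hn
  have h4 : -Real.log δ ≤ n / (1024 * b ^ 2) := by
    rw [le_div_iff₀ (by positivity)]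
    rw [one_div, Real.log_inv] at hnδ
    linarith
  -- The exponent splits into two equal shares, one for the union bound and one for δ.
  have h5 : n * (5 / (16 * b)) ^ 2 / 50 = n / (1024 * b ^ 2) + n / (1024 * b ^ 2) := by
    field_simp; norm_num
  calc _ ≤ M ^ k * Real.exp (-(n * (5 / (16 * b)) ^ 2 / 50)) := by gcongr
    _ = Real.exp (k * l - n * (5 / (16 * b)) ^ 2 / 50) := by
        rw [h2, ← Real.exp_add]; ring_nf
    _ ≤ Real.exp (Real.log δ) := Real.exp_le_exp.2 (by rw [h5]; linarith)
    _ = δ := Real.exp_log hδ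

/-- This is the numerical condition for packing at ρ = 1/(16b): the squared count is at most exp(4d
log M), against a tail exp(-n/(64b)). -/
theorem packing_bound_lt {d m n : ℕ} {b : ℝ} (hd : 1 ≤ d) (hb : 2 ≤ b) (hm : 1 ≤ m) (hn0 : 1 ≤ n)
    (hn : 10240 * (d * b ^ 4) * Real.log (n * (32 * m) + 1) ≤ n) :
    (((n * (32 * m) + 1) ^ d + 1 : ℕ) : ℝ) ^ 2 * Real.exp (-(1 / (16 * b) / 4 * n)) < 1 := by
  have hb0 : 0 < b := by linarith
  have hd' : (1 : ℝ) ≤ d := by exact_mod_cast hd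
  have hm' : (1 : ℝ) ≤ m := by exact_mod_cast hm
  have hn' : (1 : ℝ) ≤ n := by exact_mod_cast hn0
  push_cast
  set M : ℝ := n * (32 * m) + 1 with hM
  have hM0 : 0 < M := by positivity
  have hM2 : 2 ≤ M := by rw [hM]; nlinarith
  set l := Real.log M with hl
  have hl0 : 0 < l := Real.log_pos (by linarith)
  have h1 : M ^ d + 1 ≤ M ^ (d * 2) := by
    have : 2 ≤ M ^ d := hM2.trans (le_self_pow₀ (by linarith) (by omega))
    rw [pow_mul]
    nlinarith
  have h2 : (M ^ (d * 2)) ^ 2 = Real.exp (4 * d * l) := by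
    rw [← pow_mul, ← Real.exp_log (pow_pos hM0 _), Real.log_pow, hl]
    push_cast
    ring_nf
  have h3 : 4 * d * l < n / (64 * b) := by
    rw [lt_div_iff₀ (by positivity)]
    refine lt_of_lt_of_le ?_ hn
    have hb4 : b ≤ b ^ 4 := le_self_pow₀ (by linarith) (by norm_num)
    have h5 : d * b * l ≤ d * b ^ 4 * l := by gcongr
    have h6 : 0 < d * b * l := by positivity
    linarith
  have h4 : 1 / (16 * b) / 4 * n = n / (64 * b) := by field_simp; norm_num
  calc _ ≤ (M ^ (d * 2)) ^ 2 * Real.exp (-(n / (64 * b))) := by rw [h4]; gcongr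
    _ = Real.exp (4 * d * l - n / (64 * b)) := by rw [h2, ← Real.exp_add]; ring_nf
    _ < 1 := by rw [← Real.exp_zero]; exact Real.exp_lt_exp.2 (by linarith)

end LSBoost

/-! ### Choice of constants and conclusion -/

theorem mainTheorem11 :
    ∃ C : ℝ, 0 < C ∧
      ∀ (X : Type*) [MeasurableSpace X] (H : Set (X → ℝ)) (d : ℕ)
        (A : Measure (LSBoost.Example X) → X → ℝ) (f : X → ℝ)
        (μ : Measure (LSBoost.Example X)) [IsProbabilityMeasure μ]
        (ε δ α B : ℝ) (n : ℕ),
        (∀ h ∈ H, Measurable h) →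
        LSBoost.AffineClosed H →
        LSBoost.HasPseudodimension H d →
        LSBoost.IsRegressionOracle H A →
        Measurable f → (∀ x, f x ∈ Set.Icc (0 : ℝ) 1) →
        0 < ε → 0 < δ → 0 < α → 0 < B →
        Measurable (fun p : (Fin n → LSBoost.Example X) × X =>
          LSBoost.output f α A (LSBoost.empirical p.1) B p.2) →
        C * (d * B ^ 3 * Real.log (d * B / α) ^ 2 / (α ^ 3 * ε ^ 2)
          + Real.log (1 / δ) / ε ^ 2) ≤ n →
        ε ≤ α / (4 * B) →
        1 - 2 * δ ≤ (Measure.pi (fun _ : Fin n => μ)).real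
          {S | LSBoost.ApproxMulticalibrated (2 * α) μ (LSBoost.boundedPart H B)
            (LSBoost.output f α A (LSBoost.empirical S) B)} := by
  -- Any C with 16C ≥ 1600000 serves the estimates below.
  refine ⟨100000, by norm_num, ?_⟩
  intro X _ H d A f μ _ ε δ α B n hHm hH hd hA hf _ hε hδ hα hB hout hn hεB
  rcases le_total B (2 * α) with hsmall | hbig
  · have : {S : Fin n → LSBoost.Example X | LSBoost.ApproxMulticalibrated (2 * α) μ
        (LSBoost.boundedPart H B) (LSBoost.output f α A (LSBoost.empirical S) B)} = Set.univ :=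
      Set.eq_univ_of_forall fun S => LSBoost.approxMulticalibrated_of_le
        (LSBoost.measurable_iter hA hHm hf α _ B _) (LSBoost.iter_mem_grid f α A _ B _)
        (fun v => LSBoost.mem_Icc_of_mem_grid) μ hB.le hsmall
    rw [this, probReal_univ]
    linarith
  rcases le_total 1 δ with hδ1 | hδ1
  · exact le_trans (by linarith) measureReal_nonneg
  obtain ⟨x⟩ : Nonempty X := by
    obtain ⟨z⟩ := nonempty_of_isProbabilityMeasure μ
    exact ⟨z.1⟩
  -- The oracle supplies the member of H that is needed here.
  have hd1 := LSBoost.one_le_of_hasPseudodimension hH (hA.mem μ) x hd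
  have hd1' : (1 : ℝ) ≤ d := by exact_mod_cast hd1
  obtain ⟨b, hb⟩ : ∃ b, b = B / α := ⟨_, rfl⟩
  have hb2 : 2 ≤ b := by rw [hb, le_div_iff₀ hα]; exact hbig
  have hb0 : 0 < b := by linarith
  set L := Real.log (d * b) with hL
  have hδL : 0 ≤ Real.log (1 / δ) := Real.log_nonneg ((one_le_div hδ).2 hδ1)
  -- The bound ε ≤ 1/(4b) trades 1/ε² for 16b², raising b³ to b⁵ in the sample size.
  have hε2 : 16 * b ^ 2 ≤ 1 / ε ^ 2 := by
    have h1 : ε * (4 * b) ≤ 1 := by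
      have : α / (4 * B) * (4 * b) = 1 := by rw [hb]; field_simp
      calc ε * (4 * b) ≤ α / (4 * B) * (4 * b) := by gcongr
        _ = 1 := this
    rw [le_div_iff₀ (by positivity)]
    calc 16 * b ^ 2 * ε ^ 2 = (ε * (4 * b)) ^ 2 := by ring
      _ ≤ 1 := pow_le_one₀ (by positivity) h1
  have hn' : 100000 * ((d * b ^ 3 * L ^ 2 + Real.log (1 / δ)) * (1 / ε ^ 2)) ≤ n := by
    refine le_trans (le_of_eq ?_) hn
    rw [hL, hb, mul_div_assoc]
    field_simp
  have hn'' : 100000 * ((d * b ^ 3 * L ^ 2 + Real.log (1 / δ)) * (16 * b ^ 2)) ≤ n := by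
    refine le_trans ?_ hn'
    gcongr
  have hpos : 0 ≤ d * b ^ 5 * L ^ 2 := by positivity
  have hposδ : 0 ≤ b ^ 2 * Real.log (1 / δ) := by positivity
  have hn1 : 1600000 * (d * b ^ 5 * L ^ 2) ≤ n := by
    refine le_trans ?_ hn''
    linarith [show (d * b ^ 3 * L ^ 2 + Real.log (1 / δ)) * (16 * b ^ 2)
      = 16 * (d * b ^ 5 * L ^ 2) + 16 * (b ^ 2 * Real.log (1 / δ)) by ring]
  have hnδ : 1024 * b ^ 2 * Real.log (1 / δ) ≤ n := by
    refine le_trans ?_ hn''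
    linarith [show (d * b ^ 3 * L ^ 2 + Real.log (1 / δ)) * (16 * b ^ 2)
      = 16 * (d * b ^ 5 * L ^ 2) + 16 * (b ^ 2 * Real.log (1 / δ)) by ring]
  have hL0 : 0 < L := Real.log_pos (by nlinarith)
  have hn0 : 1 ≤ n := by
    have : (0 : ℝ) < n := lt_of_lt_of_le (by positivity) hn1
    exact_mod_cast this
  have hn0' : (1 : ℝ) ≤ n := by exact_mod_cast hn0
  set m := LSBoost.gridSize α B with hm
  have hm1 : 1 ≤ m := LSBoost.gridSize_pos hα hB
  have hm1' : (1 : ℝ) ≤ m := by exact_mod_cast hm1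
  have hmlow : 2 * b ≤ m := by rw [hb, ← mul_div_assoc]; exact Nat.le_ceil _
  have hmb : (m : ℝ) ≤ 5 / 2 * b := by
    have : (m : ℝ) < 2 * B / α + 1 := Nat.ceil_lt_add_one (by positivity)
    rw [mul_div_assoc, ← hb] at this
    linarith
  -- The factor 81 comes from 32nm + 1 ≤ 80nb + 1 ≤ 81nb.
  have hlog : 10240 * (d * b ^ 4) * Real.log (n * (32 * m) + 1) ≤ n := by
    refine le_trans ?_ (LSBoost.mul_log_le_of_le hd1' hb2 hL hn1)
    gcongr
    nlinarith [mul_le_mul_of_nonneg_left hmb (zero_le_one.trans hn0')]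
  have hrho : α / (16 * B) = 1 / (16 * b) := by rw [hb]; field_simp
  -- Packing needs resolution times ρ to be at least 4; with resolution 32m it is 2m/b ≥ 4.
  obtain ⟨N, hNH, hNc, hN⟩ := LSBoost.exists_finset_net hH hHm hd (m := 32 * m) (by omega) μ
    (ρ := 1 / (16 * b))
    ((div_le_one_of_le₀ (by linarith) (by positivity)).trans (by norm_num))
    (by
      push_cast
      rw [mul_one_div, le_div_iff₀ (by positivity)]
      linarith)
    (LSBoost.packing_bound_lt hd1 hb2 hm1 hn0 hlog)
  have hn128 : 128 * (B / α) ^ 2 ≤ n := by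
    rw [← hb]
    have h1 : Real.log 2 ≤ Real.log (n * (32 * m) + 1) :=
      Real.log_le_log (by norm_num) (by nlinarith)
    have h2 : (1 : ℝ) / 2 ≤ Real.log (n * (32 * m) + 1) := by linarith [Real.log_two_gt_d9]
    refine le_trans ?_ hlog
    calc 128 * b ^ 2 ≤ 10240 * (1 * b ^ 4) * (1 / 2) := by
          have : b ^ 2 ≤ b ^ 4 := pow_le_pow_right₀ (by linarith) (by norm_num)
          nlinarith
      _ ≤ _ := by gcongr
  rw [← hrho] at hN
  refine le_trans ?_ (LSBoost.one_sub_le_measureReal_multicalibrated hd hH hHm hA hf hα hbig μ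
    hn128 hout hNH hN)
  have := LSBoost.union_bound_le hd1 hb2 hδ hmb hm1 hn0 hlog hnδ hNc
  rw [← hb, ← hm]
  linarith
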